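/- Let $\mathcal A$ be a (possibly non-commutative) unital real algebra and $\phi:\mathcal A\to\mathbb R$ a linear functional with $\phi(1)=1$. For $Y_1,\dots,Y_n\in\mathcal A$ let $M[Y_1,\dots,Y_n]=\phi(Y_1\cdots Y_n)$, and let the joint free cumulants be defined recursively by $$R[Y_1,\dots,Y_n]=M[Y_1,\dots,Y_n]-\sum_{\pi\in NC(n),\ \pi\ne\hat 1}R_\pi[Y_1,\dots,Y_n],\qquad R_\pi[Y_1,\dots,Y_n]=\prod_{B\in\pi}R[Y_i:i\in B],$$ where $NC(n)$ is the set of non-crossing partitions of $\{1,\dots,n\}$, $\hat 1$ is the partition with one class, and the entries indexed by $B$ are taken in increasing order. The free Appell polynomials $A_{Y_1,\dots,Y_n}(x_1,\dots,x_n)\in\mathbb R\langle x_1,\dots,x_n\rangle$ are the unique family of polynomials in non-commuting variables such that - $A_\emptyset=1$; - for $1\le i\le n$, $\partial_i A_{Y_1,\dots,Y_n}(x_1,\dots,x_n)=A_{Y_1,\dots,Y_{i-1}}(x_1,\dots,x_{i-1})\,A_{Y_{i+1},\dots,Y_n}(x_{i+1},\dots,x_n)$, where $\partial_i$ is the linear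 map which sends a monomial to the sum of all monomials obtained from it by deleting one occurrence of $x_i$; - $\phi\bigl(A_{Y_1,\dots,Y_n}(Y_1,\dots,Y_n)\bigr)=0$ for $n\ge1$; - in each monomial of $A_{Y_1,\dots,Y_n}$ the variables appear in increasing order of indices. Write $A[Y_1,\dots,Y_n]=A_{Y_1,\dots,Y_n}(Y_1,\dots,Y_n)\in\mathcal A$. Let $(X_i)_{i\in I}$ be a family of elements of $\mathcal A$. For $\vec u=(u(1),\dots,u(n))\in I^n$ write $X_{\vec u}=X_{u(1)}\cdots X_{u(n)}$ for the product, and $$M[X_{\vec u}]=M[X_{u(1)},\dots,X_{u(n)}],\quad R_\pi[X_{\vec u}]=R_\pi[X_{u(1)},\dots,X_{u(n)}],\quad A[X_{\vec u}]=A[X_{u(1)},\dots,X_{u(n)}].$$ Let $k\ge1$, $s(1),\dots,s(k)\ge 1$, $N=s(1)+\dots+s(k)$, let $\vec u_i\in I^{s(i)}$, and let $\vec u=(\vec u_1,\dots,\vec u_k)\in I^N$ be the concatenation. Let $\sigma=\pi_{s(1),\dots,s(k)}$ be the partition of $\{1,\dots,N\}$ into consecutive intervals of lengths $s(1),\dots,s(k)$.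 A partition $\pi$ of $\{1,\dots,N\}$ is called *non-homogeneous* if no class of $\pi$ is contained in a class of $\sigma$, and *connected* if $\pi\vee\sigma=\hat 1$ in the lattice of all partitions of $\{1,\dots,N\}$. **Theorem.** In the sums below, $\pi$ ranges over the partitions in $NC(N)$ with the indicated property. 1. $\displaystyle M\bigl[X_{\vec u_1},X_{\vec u_2},\dots,X_{\vec u_k}\bigr]=M[X_{\vec u}]=\sum_{\pi\in NC(N)}R_\pi[X_{\vec u}]$. 2. $\displaystyle M\bigl[A[X_{\vec u_1}],\dots,A[X_{\vec u_k}]\bigr]=\sum_{\pi\ \text{non-homogeneous}}R_\pi[X_{\vec u}]$. 3. $\displaystyle R\bigl[(X_{\vec u_1}),\dots,(X_{\vec u_k})\bigr]=\sum_{\pi\ \text{connected}}R_\pi[X_{\vec u}]$, where the left-hand side is the free cumulant of the $k$ elements $X_{\vec u_1},\dots,X_{\vec u_k}$ of $\mathcal A$. 4. $\displaystyle R\bigl[A[X_{\vec u_1}],\dots,A[X_{\vec u_k}]\bigr]=\sum_{\pi\ \text{connected and non-homogeneous}}R_\pi[X_{\vec u}]$. In particular, let $A_{\vec u_i}(\mathbf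 x)=A_{X_{u_i(1)},\dots,X_{u_i(s(i))}}(x_{u_i(1)},\dots,x_{u_i(s(i))})$, a polynomial in the non-commuting variables $(x_j)_{j\in I}$, and let $\phi_{\mathbf X}[P]=\phi(P(\mathbf X))$ be the joint distribution of the family. Then the linearization coefficient $\phi_{\mathbf X}\bigl[A_{\vec u_1}(\mathbf x)\cdots A_{\vec u_k}(\mathbf x)\bigr]$ equals the sum of $R_\pi[X_{\vec u}]$ over the non-homogeneous partitions $\pi\in NC(N)$. -/

import Mathlib

noncomputable section

namespace FreeAppell

/-! ### Set partitions of `{1, …, n}` (indexed by `Fin n`) -/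

/-- Set partitions of an `n`-element ordered set. The order `≤` is refinement: `⊥` is the partition
into singletons and `⊤` is the partition with a single class. -/
abbrev Part (n : ℕ) : Type := Finpartition (Finset.univ : Finset (Fin n))

/-- `i` and `j` lie in the same class of `π`. -/
def SameClass {n : ℕ} (π : Part n) (i j : Fin n) : Prop :=
  ∃ B ∈ π.parts, i ∈ B ∧ j ∈ B

/-- Non-crossing partitions: if `i < j < k`, `i ∼ k`, `j ∼ l` and `i ≁ j`, then `i < l < k`. -/
def IsNonCrossing {n : ℕ} (π : Part n) : Prop :=
  ∀ i j k l : Fin n, i < j → j < k → SameClass π i k → SameClass π j l → ¬ SameClass π i j →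
    i < l ∧ l < k

open scoped Classical in
/-- The finite set of all non-crossing partitions. -/
def NC (n : ℕ) : Finset (Part n) := Finset.univ.filter IsNonCrossing

/-- The class `B` is homogeneous with respect to `σ`. -/
def IsHomogeneousClass {n : ℕ} (σ : Part n) (B : Finset (Fin n)) : Prop :=
  ∃ C ∈ σ.parts, B ⊆ C

/-- `π` is non-homogeneous with respect to `σ`: it has no homogeneous classes. -/
def IsNonHomogeneous {n : ℕ} (σ π : Part n) : Prop :=
  ∀ B ∈ π.parts, ¬ IsHomogeneousClass σ B

/-- `π` is connected with respect to `σ`: the join of `π` and `σ` in the lattice of all partitions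
is the one-class partition. -/
def IsConnectedTo {n : ℕ} (σ π : Part n) : Prop :=
  IsLUB {π, σ} (⊤ : Part n)

open scoped Classical in
/-- The interval partition of `{1, …, s(1) + ⋯ + s(k)}` into consecutive intervals of lengths
`s(1), …, s(k)`. The equivalence `finSigmaFinEquiv` sends `(i, j)` to the position
`s(1) + ⋯ + s(i - 1) + j`. -/
def intervalPartition {k : ℕ} (s : Fin k → ℕ) : Part (∑ i, s i) :=
  Finpartition.ofSetoid
    (Setoid.ker fun p : Fin (∑ i, s i) => (finSigmaFinEquiv.symm p).1)

/-- The concatenation `(u_1, …, u_k)` of multi-indices `u_i` of lengths `s(i)`. -/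
def concat {I : Type*} {k : ℕ} {s : Fin k → ℕ} (u : ∀ i, Fin (s i) → I) :
    Fin (∑ i, s i) → I :=
  fun p => u (finSigmaFinEquiv.symm p).1 (finSigmaFinEquiv.symm p).2

/-! ### Joint moments and joint free cumulants -/

variable {A : Type*} [Ring A] [Algebra ℝ A]

/-- The ordered product `X_1 X_2 ⋯ X_n`. -/
def orderedProd {n : ℕ} (X : Fin n → A) : A := (List.ofFn X).prod

/-- The joint moment `M[X_1, …, X_n] = φ(X_1 ⋯ X_n)`. -/
def jointMoment (φ : A →ₗ[ℝ] ℝ) {n : ℕ} (X : Fin n → A) : ℝ := φ (orderedProd X)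

/-- The subtuple `(X_i : i ∈ B)`, taken in increasing order of the indices. -/
def subtuple {A : Type*} {n : ℕ} (X : Fin n → A) (B : Finset (Fin n)) : Fin B.card → A :=
  fun j => X (B.orderEmbOfFin rfl j)

theorem card_lt_of_ne_top {n : ℕ} {π : Part n} (hπ : π ≠ ⊤) {B : Finset (Fin n)}
    (hB : B ∈ π.parts) : B.card < n := by
  by_contra h
  apply hπ
  have hBu : B = Finset.univ := by
    rw [← Finset.card_eq_iff_eq_univ, Fintype.card_fin]
    exact le_antisymm (by simpa using Finset.card_le_univ B) (not_lt.1 h)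
  rw [eq_top_iff]
  intro C hC
  exact ⟨B, hB, by rw [hBu]; exact Finset.subset_univ C⟩

open scoped Classical in
/-- The joint free cumulant, defined recursively by
`R[X_1, …, X_n] = M[X_1, …, X_n] - ∑_{π ∈ NC(n), π ≠ ⊤} ∏_{B ∈ π} R[X_i : i ∈ B]`
(see `freeCumulant_eq`). -/
def freeCumulant (φ : A →ₗ[ℝ] ℝ) {n : ℕ} (X : Fin n → A) : ℝ :=
  jointMoment φ X - ∑ π ∈ ((NC n).filter (fun π => π ≠ ⊤)).attach,
    ∏ B ∈ π.1.parts.attach, freeCumulant φ (subtuple X B.1)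
termination_by n
decreasing_by exact card_lt_of_ne_top (Finset.mem_filter.1 π.2).2 B.2

/-- The partitioned free cumulant `R_π[X_1, …, X_n] = ∏_{B ∈ π} R[X_i : i ∈ B]`. -/
def partCumulant (φ : A →ₗ[ℝ] ℝ) {n : ℕ} (π : Part n) (X : Fin n → A) : ℝ :=
  ∏ B ∈ π.parts, freeCumulant φ (subtuple X B)

open scoped Classical in
theorem freeCumulant_eq (φ : A →ₗ[ℝ] ℝ) {n : ℕ} (X : Fin n → A) :
    freeCumulant φ X =
      jointMoment φ X - ∑ π ∈ (NC n).filter (fun π => π ≠ ⊤), partCumulant φ π X := by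
  rw [freeCumulant]
  congr 1
  rw [← Finset.sum_attach ((NC n).filter (fun π => π ≠ ⊤))]
  refine Finset.sum_congr rfl fun π _ => ?_
  rw [partCumulant, ← Finset.prod_attach π.1.parts]

/-! ### Free Appell polynomials -/

/-- The basis of the monomials `x_w` in the algebra of non-commutative polynomials. -/
abbrev monomial {I : Type*} (w : FreeMonoid I) : FreeAlgebra ℝ I :=
  FreeAlgebra.basisFreeMonoid ℝ I w

open scoped Classical in
/-- The partial derivative `∂_i`, the linear extension of
`∂_i x_w = ∑_{j : w(j) = i} x_{w(1)} ⋯ x̂_{w(j)} ⋯ x_{w(k)}`. -/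
def partialDeriv {I : Type*} (i : I) : FreeAlgebra ℝ I →ₗ[ℝ] FreeAlgebra ℝ I :=
  (FreeAlgebra.basisFreeMonoid ℝ I).constr ℝ fun w =>
    ∑ j : Fin w.toList.length,
      if w.toList.get j = i then monomial (FreeMonoid.ofList (w.toList.eraseIdx j)) else 0

/-- Substitution: `evalAt y P = P(y_1, …, y_n)`. -/
abbrev evalAt {B : Type*} [Ring B] [Algebra ℝ B] {I : Type*} (y : I → B) (P : FreeAlgebra ℝ I) : B :=
  FreeAlgebra.lift ℝ y P

/-- The first `i` entries of a tuple (those strictly before the entry with index `i`). -/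
def before {B : Type*} {n : ℕ} (X : Fin n → B) (i : Fin n) : Fin i → B :=
  fun j => X ⟨j, j.2.trans i.2⟩

/-- The entries of a tuple strictly after the entry with index `i`. -/
def after {B : Type*} {n : ℕ} (X : Fin n → B) (i : Fin n) : Fin (n - (i + 1)) → B :=
  fun j => X ⟨i + 1 + j, by have := j.2; have := i.2; omega⟩

/-- The defining conditions of the multivariate free Appell polynomials
`A_{X_1, …, X_n}(x_1, …, x_n)`, for all tuples `X_1, …, X_n` of random variables at once. -/
structure IsFreeAppellFamily (φ : A →ₗ[ℝ] ℝ)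
    (P : ∀ n : ℕ, (Fin n → A) → FreeAlgebra ℝ (Fin n)) : Prop where
  /-- `A_∅ = 1`. -/
  empty : ∀ X : Fin 0 → A, P 0 X = 1
  /-- `∂_i A_{X_1, …, X_n}(x_1, …, x_n)
    = A_{X_1, …, X_{i-1}}(x_1, …, x_{i-1}) ⬝ A_{X_{i+1}, …, X_n}(x_{i+1}, …, x_n)`. -/
  deriv : ∀ (n : ℕ) (X : Fin n → A) (i : Fin n),
    partialDeriv i (P n X) =
      evalAt (before (FreeAlgebra.ι ℝ) i) (P i (before X i)) *
        evalAt (after (FreeAlgebra.ι ℝ) i) (P (n - (i + 1)) (after X i))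
  /-- `φ(A_{X_1, …, X_n}(X_1, …, X_n)) = 0` for `n ≥ 1`. -/
  centered : ∀ (n : ℕ) (X : Fin n → A), 0 < n → φ (evalAt X (P n X)) = 0
  /-- In each monomial, the variables appear in the increasing order of indices. -/
  ordered : ∀ (n : ℕ) (X : Fin n → A),
    ∀ w ∈ ((FreeAlgebra.basisFreeMonoid ℝ (Fin n)).repr (P n X)).support,
      w.toList.Pairwise (· ≤ ·)

/-- The multivariate free Appell polynomials `A_{X_1, …, X_n}(x_1, …, x_n)`: the family determined
by the conditions `IsFreeAppellFamily`. It exists and is unique when `φ` is unital, see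
`existsUnique_isFreeAppellFamily`. -/
def freeAppellPoly (φ : A →ₗ[ℝ] ℝ) {n : ℕ} (X : Fin n → A) : FreeAlgebra ℝ (Fin n) :=
  Classical.epsilon (IsFreeAppellFamily φ) n X

/-- The random variable `A[X_1, …, X_n] = A_{X_1, …, X_n}(X_1, …, X_n)`. -/
def freeAppell (φ : A →ₗ[ℝ] ℝ) {n : ℕ} (X : Fin n → A) : A :=
  evalAt X (freeAppellPoly φ X)

/-- For a fixed family `(X_i)`, the polynomial
`A_u(x) = A_{X_{u(1)}, …, X_{u(k)}}(x_{u(1)}, …, x_{u(k)})` in the variables `(x_i)`. -/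
def freeAppellPolyAt (φ : A →ₗ[ℝ] ℝ) {I : Type*} (X : I → A) {n : ℕ} (u : Fin n → I) :
    FreeAlgebra ℝ I :=
  evalAt (fun j => FreeAlgebra.ι ℝ (u j)) (freeAppellPoly φ (fun j => X (u j)))

/-- The joint distribution of the family `(X_i)`: the functional on non-commutative polynomials
with `φ_X[x_u] = φ(X_u)`. -/
def jointDistribution (φ : A →ₗ[ℝ] ℝ) {I : Type*} (X : I → A) (P : FreeAlgebra ℝ I) : ℝ :=
  φ (evalAt X P)

/-! ### Existence and uniqueness of the free Appell polynomials -/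

section ExistsUnique

variable {I : Type*}

theorem monomial_one : monomial (1 : FreeMonoid I) = 1 := by
  simp [monomial, FreeAlgebra.basisFreeMonoid, FreeAlgebra.equivMonoidAlgebraFreeMonoid]

theorem monomial_of_mul (x : I) (w : FreeMonoid I) :
    monomial (FreeMonoid.of x * w) = FreeAlgebra.ι ℝ x * monomial w := by
  simp [monomial, FreeAlgebra.basisFreeMonoid, FreeAlgebra.equivMonoidAlgebraFreeMonoid]

open scoped Classical in
theorem partialDeriv_monomial (i : I) (w : FreeMonoid I) :
    partialDeriv i (monomial w) = ∑ j : Fin w.toList.length,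
      if w.toList.get j = i then monomial (FreeMonoid.ofList (w.toList.eraseIdx j)) else 0 := by
  simp only [partialDeriv, monomial, Module.Basis.constr_basis]

theorem partialDeriv_one (i : I) : partialDeriv i (1 : FreeAlgebra ℝ I) = 0 := by
  rw [← monomial_one, partialDeriv_monomial]
  exact Finset.sum_eq_zero fun j _ => absurd j.2 (Nat.not_lt_zero _)

open scoped Classical in
theorem partialDeriv_ι_mul (i x : I) (P : FreeAlgebra ℝ I) :
    partialDeriv i (FreeAlgebra.ι ℝ x * P) =
      (if x = i then P else 0) + FreeAlgebra.ι ℝ x * partialDeriv i P := by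
  have h : (partialDeriv i) ∘ₗ (LinearMap.mulLeft ℝ (FreeAlgebra.ι ℝ x)) =
      (if x = i then LinearMap.id else 0) +
        (LinearMap.mulLeft ℝ (FreeAlgebra.ι ℝ x)) ∘ₗ (partialDeriv i) := by
    refine (FreeAlgebra.basisFreeMonoid ℝ I).ext fun w => ?_
    have h1 := partialDeriv_monomial i w
    have h2 := partialDeriv_monomial i (FreeMonoid.of x * w)
    rw [monomial_of_mul] at h2
    simp only [LinearMap.comp_apply, LinearMap.mulLeft_apply, LinearMap.add_apply]
    refine h2.trans ?_
    rw [show partialDeriv i (FreeAlgebra.basisFreeMonoid ℝ I w) = _ from h1]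
    erw [Fin.sum_univ_succ]
    congr 1
    · by_cases hx : x = i
      · simp [hx]
      · simp [hx]
    · rw [Finset.mul_sum]
      refine Finset.sum_congr rfl fun j _ => ?_
      by_cases hj : w.toList.get j = i
      · have : (FreeMonoid.of x * w).toList.get j.succ = i := hj
        rw [if_pos hj, if_pos this, ← monomial_of_mul]
        rfl
      · have : ¬ (FreeMonoid.of x * w).toList.get j.succ = i := hj
        rw [if_neg hj, if_neg this, mul_zero]
  have := LinearMap.congr_fun h P
  by_cases hx : x = i
  · simpa [hx] using this
  · simpa [hx] using this

/-- The recursion `W(a, m + 1) = y_a W(a + 1, m) - ∑_k c(a, k) W(a + k + 1, m - k)`; here `W(a, m)`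
uses the variables `y_a, …, y_{a + m - 1}`. -/
def recW {B : Type*} [Ring B] [Algebra ℝ B] (c : ℕ → ℕ → ℝ) (y : ℕ → B) : ℕ → ℕ → B
  | 0, _ => 1
  | m + 1, a => y a * recW c y m (a + 1) -
      ∑ k : Fin (m + 1), c a k • recW c y (m - k) (a + k + 1)
termination_by m => m

/-- The recursion `recW` with the coefficients chosen so that the result is centered. -/
def recV (φ : A →ₗ[ℝ] ℝ) (Y : ℕ → A) : ℕ → ℕ → A
  | 0, _ => 1
  | m + 1, a => Y a * recV φ Y m (a + 1) -
      ∑ k : Fin (m + 1), φ (Y a * recV φ Y k (a + 1)) • recV φ Y (m - k) (a + k + 1)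
termination_by m => m

theorem recV_eq_recW (φ : A →ₗ[ℝ] ℝ) (Y : ℕ → A) (m a : ℕ) :
    recV φ Y m a = recW (fun a k => φ (Y a * recV φ Y k (a + 1))) Y m a := by
  induction m using Nat.strong_induction_on generalizing a with
  | _ m ih =>
    cases m with
    | zero => rw [recV, recW]
    | succ m =>
      rw [recV, recW, ih m (Nat.lt_succ_self m)]
      congr 1
      exact Finset.sum_congr rfl fun k _ => by rw [ih (m - k) (by omega)]

theorem recV_congr (φ : A →ₗ[ℝ] ℝ) (Y Y' : ℕ → A) (m a a' : ℕ)
    (h : ∀ j < m, Y (a + j) = Y' (a' + j)) : recV φ Y m a = recV φ Y' m a' := by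
  induction m using Nat.strong_induction_on generalizing a a' with
  | _ m ih =>
    cases m with
    | zero => rw [recV, recV]
    | succ m =>
      have h0 : Y a = Y' a' := h 0 (Nat.succ_pos m)
      have key : ∀ k l : ℕ, k + l ≤ m →
          recV φ Y l (a + k + 1) = recV φ Y' l (a' + k + 1) := fun k l hkl =>
        ih l (by omega) _ _ fun j hj => by
          have := h (k + 1 + j) (by omega)
          simpa only [Nat.add_assoc] using this
      have key0 : ∀ l ≤ m, recV φ Y l (a + 1) = recV φ Y' l (a' + 1) :=
        fun l hl => key 0 l (by omega)
      rw [recV, recV, h0, key0 m le_rfl]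
      congr 1
      exact Finset.sum_congr rfl fun k _ => by
        have := k.2
        rw [key k (m - k) (by omega), key0 k (by omega)]

theorem recW_congr {B : Type*} [Ring B] [Algebra ℝ B] (c c' : ℕ → ℕ → ℝ) (y y' : ℕ → B)
    (m a a' : ℕ) (h : ∀ j < m, y (a + j) = y' (a' + j))
    (hc : ∀ j k, j + k < m → c (a + j) k = c' (a' + j) k) :
    recW c y m a = recW c' y' m a' := by
  induction m using Nat.strong_induction_on generalizing a a' with
  | _ m ih =>
    cases m with
    | zero => rw [recW, recW]
    | succ m =>
      have h0 : y a = y' a' := h 0 (Nat.succ_pos m)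
      have key : ∀ k l : ℕ, k + l ≤ m →
          recW c y l (a + k + 1) = recW c' y' l (a' + k + 1) := fun k l hkl =>
        ih l (by omega) _ _
          (fun j hj => by
            have := h (k + 1 + j) (by omega)
            simpa only [Nat.add_assoc] using this)
          (fun j k' hj => by
            have := hc (k + 1 + j) k' (by omega)
            simpa only [Nat.add_assoc] using this)
      rw [recW, recW, h0, show recW c y m (a + 1) = recW c' y' m (a' + 1) from
        key 0 m (by omega)]
      congr 1
      exact Finset.sum_congr rfl fun k _ => by
        have := k.2
        rw [key k (m - k) (by omega), show c a k = c' a' k from hc 0 k (by omega)]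

theorem map_recW {B C : Type*} [Ring B] [Algebra ℝ B] [Ring C] [Algebra ℝ C] (f : B →ₐ[ℝ] C)
    (c : ℕ → ℕ → ℝ) (y : ℕ → B) (m a : ℕ) :
    f (recW c y m a) = recW c (fun j => f (y j)) m a := by
  induction m using Nat.strong_induction_on generalizing a with
  | _ m ih =>
    cases m with
    | zero => rw [recW, recW, map_one]
    | succ m =>
      rw [recW, recW, map_sub, map_mul, map_sum, ih m (Nat.lt_succ_self m)]
      congr 1
      exact Finset.sum_congr rfl fun k _ => by rw [map_smul, ih (m - k) (by omega)]

theorem recV_centered (φ : A →ₗ[ℝ] ℝ) (hφ : φ 1 = 1) (Y : ℕ → A) (m a : ℕ) (hm : 0 < m) :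
    φ (recV φ Y m a) = 0 := by
  induction m using Nat.strong_induction_on generalizing a with
  | _ m ih =>
    cases m with
    | zero => exact absurd hm (lt_irrefl 0)
    | succ m =>
      rw [recV, map_sub, map_sum, Fin.sum_univ_castSucc, Finset.sum_eq_zero, zero_add]
      · simp [recV, hφ]
      · intro k _
        have := k.2
        rw [map_smul, ih _ (by simp) _ (by simp), smul_zero]

/-- Extension of a finite tuple by zero. -/
def ext0 {B : Type*} [Zero B] {n : ℕ} (X : Fin n → B) (j : ℕ) : B :=
  if h : j < n then X ⟨j, h⟩ else 0

theorem ext0_of_lt {B : Type*} [Zero B] {n : ℕ} (X : Fin n → B) {j : ℕ} (h : j < n) :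
    ext0 X j = X ⟨j, h⟩ := dif_pos h

theorem map_ext0 {B C : Type*} [Ring B] [Algebra ℝ B] [Ring C] [Algebra ℝ C] (f : B →ₐ[ℝ] C)
    {n : ℕ} (X : Fin n → B) (j : ℕ) : f (ext0 X j) = ext0 (fun i => f (X i)) j := by
  unfold ext0
  split_ifs <;> simp

/-- The coefficients of the recursion. -/
def recC (φ : A →ₗ[ℝ] ℝ) {n : ℕ} (X : Fin n → A) (a k : ℕ) : ℝ :=
  φ (ext0 X a * recV φ (ext0 X) k (a + 1))

/-- The explicit family satisfying the defining conditions. -/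
def recP (φ : A →ₗ[ℝ] ℝ) (n : ℕ) (X : Fin n → A) : FreeAlgebra ℝ (Fin n) :=
  recW (recC φ X) (ext0 (FreeAlgebra.ι ℝ)) n 0

theorem partialDeriv_recW {n : ℕ} (c : ℕ → ℕ → ℝ) (i : Fin n) (m a : ℕ) (ham : a + m ≤ n) :
    partialDeriv i (recW c (ext0 (FreeAlgebra.ι ℝ)) m a) =
      if a ≤ i ∧ (i : ℕ) < a + m then
        recW c (ext0 (FreeAlgebra.ι ℝ)) (i - a) a *
          recW c (ext0 (FreeAlgebra.ι ℝ)) (a + m - (i + 1)) (i + 1)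
      else 0 := by
  induction m using Nat.strong_induction_on generalizing a with
  | _ m ih =>
    cases m with
    | zero =>
      rw [recW, partialDeriv_one, if_neg (by omega)]
    | succ m =>
      have han : a < n := by omega
      have hs : ∀ k : Fin (m + 1), c a k • partialDeriv i
          (recW c (ext0 (FreeAlgebra.ι ℝ)) (m - k) (a + k + 1)) =
          if a + k + 1 ≤ i ∧ (i : ℕ) < a + (m + 1) then
            (c a k • recW c (ext0 (FreeAlgebra.ι ℝ)) (i - (a + k + 1)) (a + k + 1)) *
              recW c (ext0 (FreeAlgebra.ι ℝ)) (a + (m + 1) - (i + 1)) (i + 1)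
          else 0 := by
        intro k
        have := k.2
        rw [ih (m - k) (by omega) (a + k + 1) (by omega),
          show a + (k : ℕ) + 1 + (m - k) = a + (m + 1) by omega]
        split_ifs
        · rw [smul_mul_assoc]
        · rw [smul_zero]
      rw [recW, map_sub, map_sum, ext0_of_lt _ han, partialDeriv_ι_mul]
      simp only [map_smul, hs]
      rw [ih m (Nat.lt_succ_self m) (a + 1) (by omega),
        show a + 1 + m = a + (m + 1) by omega]
      by_cases h1 : a ≤ i ∧ (i : ℕ) < a + (m + 1)
      · rw [if_pos h1]
        by_cases h2 : a = i
        · have h3 : (⟨a, han⟩ : Fin n) = i := Fin.ext h2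
          rw [if_pos h3, if_neg (by omega), Finset.sum_eq_zero (fun k _ => if_neg (by omega))]
          rw [show (i : ℕ) - a = 0 by omega, recW, ← h2,
            show a + (m + 1) - (a + 1) = m by omega]
          simp
        · have h3 : ¬ (⟨a, han⟩ : Fin n) = i := fun h => h2 (congrArg Fin.val h)
          rw [if_neg h3, if_pos (by omega), zero_add]
          obtain ⟨p, hp⟩ : ∃ p, (i : ℕ) - a = p + 1 := ⟨i - a - 1, by omega⟩
          rw [hp, recW, sub_mul, Finset.sum_mul, ext0_of_lt _ han, mul_assoc,
            show (i : ℕ) - (a + 1) = p by omega]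
          congr 1
          have hpm : p + 1 ≤ m + 1 := by omega
          rw [Finset.sum_fin_eq_sum_range, Finset.sum_fin_eq_sum_range,
            ← Finset.sum_subset (Finset.range_mono hpm)]
          · refine Finset.sum_congr rfl fun k hk => ?_
            have hk' := Finset.mem_range.1 hk
            rw [dif_pos (by omega), dif_pos hk', if_pos (by dsimp only; omega)]
            dsimp only
            rw [show (i : ℕ) - (a + k + 1) = p - k by omega]
          · intro k hk hk'
            rw [Finset.mem_range] at hk hk'
            rw [dif_pos hk, if_neg (by dsimp only; omega)]
      · have h3 : ¬ (⟨a, han⟩ : Fin n) = i := fun h => h1 (by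
          have := congrArg Fin.val h
          dsimp only at this
          omega)
        rw [if_neg h1, if_neg h3, if_neg (by omega),
          Finset.sum_eq_zero (fun k _ => if_neg (by omega))]
        simp

/-- Span of the monomials with increasing indices, all at least `a`. -/
def incrSpan (n a : ℕ) : Submodule ℝ (FreeAlgebra ℝ (Fin n)) :=
  Submodule.span ℝ (FreeAlgebra.basisFreeMonoid ℝ (Fin n) ''
    {w | w.toList.Pairwise (· ≤ ·) ∧ ∀ x ∈ w.toList, a ≤ (x : ℕ)})

theorem incrSpan_anti {n a b : ℕ} (h : a ≤ b) : incrSpan n b ≤ incrSpan n a :=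
  Submodule.span_mono (Set.image_mono fun _ hw => ⟨hw.1, fun x hx => h.trans (hw.2 x hx)⟩)

theorem ι_mul_mem_incrSpan {n a : ℕ} (han : a < n) {P : FreeAlgebra ℝ (Fin n)}
    (hP : P ∈ incrSpan n (a + 1)) : FreeAlgebra.ι ℝ ⟨a, han⟩ * P ∈ incrSpan n a := by
  have : incrSpan n (a + 1) ≤
      (incrSpan n a).comap (LinearMap.mulLeft ℝ (FreeAlgebra.ι ℝ (⟨a, han⟩ : Fin n))) := by
    refine Submodule.span_le.2 ?_
    rintro _ ⟨w, hw, rfl⟩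
    refine Submodule.subset_span ⟨FreeMonoid.of ⟨a, han⟩ * w, ⟨?_, ?_⟩, monomial_of_mul _ _⟩
    · refine List.Pairwise.cons (fun x hx => ?_) hw.1
      exact Fin.mk_le_of_le_val ((Nat.le_succ a).trans (hw.2 x hx))
    · intro x hx
      rcases List.mem_cons.1 hx with rfl | hx
      · exact le_rfl
      · exact (Nat.le_succ a).trans (hw.2 x hx)
  exact this hP

theorem recW_mem_incrSpan {n : ℕ} (c : ℕ → ℕ → ℝ) (m a : ℕ) (ham : a + m ≤ n) :
    recW c (ext0 (FreeAlgebra.ι ℝ)) m a ∈ incrSpan n a := by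
  induction m using Nat.strong_induction_on generalizing a with
  | _ m ih =>
    cases m with
    | zero =>
      rw [recW, ← monomial_one]
      exact Submodule.subset_span ⟨1, ⟨List.Pairwise.nil, fun x hx => absurd hx List.not_mem_nil⟩,
        rfl⟩
    | succ m =>
      have han : a < n := by omega
      rw [recW, ext0_of_lt _ han]
      refine Submodule.sub_mem _ (ι_mul_mem_incrSpan han (ih m (by omega) _ (by omega))) ?_
      refine Submodule.sum_mem _ fun k _ => Submodule.smul_mem _ _ ?_
      have := k.2
      exact incrSpan_anti (by omega) (ih (m - k) (by omega) (a + k + 1) (by omega))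

theorem recC_before (φ : A →ₗ[ℝ] ℝ) {n : ℕ} (X : Fin n → A) (i : Fin n) (j k : ℕ)
    (h : j + k < i) : recC φ (before X i) j k = recC φ X j k := by
  have hi := i.2
  have hx : ∀ l < (i : ℕ), ext0 (before X i) l = ext0 X l := fun l hl => by
    rw [ext0_of_lt _ hl, ext0_of_lt _ (hl.trans hi)]
    rfl
  rw [recC, recC, hx j (by omega),
    recV_congr φ (ext0 (before X i)) (ext0 X) k (j + 1) (j + 1)
      (fun l hl => hx _ (by omega))]

theorem ext0_after {B : Type*} [Zero B] {n : ℕ} (X : Fin n → B) (i : Fin n) (l : ℕ)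
    (hl : l < n - (i + 1)) : ext0 (after X i) l = ext0 X (i + 1 + l) := by
  rw [ext0_of_lt _ hl, ext0_of_lt _ (show (i : ℕ) + 1 + l < n by omega)]
  rfl

theorem recC_after (φ : A →ₗ[ℝ] ℝ) {n : ℕ} (X : Fin n → A) (i : Fin n) (j k : ℕ)
    (h : j + k < n - (i + 1)) : recC φ (after X i) j k = recC φ X (i + 1 + j) k := by
  rw [recC, recC, ext0_after X i j (by omega),
    recV_congr φ (ext0 (after X i)) (ext0 X) k (j + 1) (i + 1 + j + 1) (fun l hl => by
      rw [ext0_after X i _ (by omega)]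
      congr 1
      omega)]

theorem evalAt_ext0 {B : Type*} [Ring B] [Algebra ℝ B] {n : ℕ} (y : Fin n → B) (c : ℕ → ℕ → ℝ)
    (m a : ℕ) :
    evalAt y (recW c (ext0 (FreeAlgebra.ι ℝ)) m a) = recW c (ext0 y) m a := by
  rw [evalAt, map_recW]
  congr 1
  funext j
  rw [map_ext0]
  simp

theorem isFreeAppellFamily_recP (φ : A →ₗ[ℝ] ℝ) (hφ : φ 1 = 1) :
    IsFreeAppellFamily φ (recP φ) where
  empty X := by rw [recP, recW]
  deriv n X i := by
    have hi := i.2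
    rw [recP, partialDeriv_recW _ _ _ _ (by omega), if_pos (by omega), recP, recP, evalAt_ext0,
      evalAt_ext0]
    congr 1
    · refine recW_congr _ _ _ _ _ _ _ (fun j hj => ?_) (fun j k hjk => ?_)
      · rw [ext0_of_lt _ (show 0 + j < n by omega), ext0_of_lt _ (show 0 + j < (i : ℕ) by omega)]
        rfl
      · rw [recC_before φ X i _ _ (by omega)]
    · rw [zero_add]
      refine recW_congr _ _ _ _ _ _ _ (fun j hj => ?_) (fun j k hjk => ?_)
      · rw [ext0_after _ i _ (by omega), zero_add]
      · rw [recC_after φ X i _ _ (by omega), zero_add]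
  centered n X hn := by
    rw [recP, evalAt_ext0]
    exact (congrArg φ (recV_eq_recW φ (ext0 X) n 0).symm).trans
      (recV_centered φ hφ (ext0 X) n 0 hn)
  ordered n X w hw := by
    have h := recW_mem_incrSpan (n := n) (recC φ X) n 0 (by omega)
    exact ((Module.Basis.mem_span_image _).1 h hw).1

theorem eq_of_eraseIdx_eq {n : ℕ} {i : Fin n} {v w : List (Fin n)}
    (hw : (i :: v).Pairwise (· ≤ ·)) (hw' : w.Pairwise (· ≤ ·)) (j : Fin w.length)
    (hj : w.get j = i) (hv : w.eraseIdx j = v) : w = i :: v := by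
  have hp : (w.get j :: w.eraseIdx j).Perm w := List.getElem_cons_eraseIdx_perm j.2
  rw [hj, hv] at hp
  exact (hp.eq_of_pairwise' hw hw').symm

open scoped Classical in
/-- A polynomial with increasing monomials and zero partial derivatives is constant. -/
theorem repr_eq_zero_of_partialDeriv {n : ℕ} (D : FreeAlgebra ℝ (Fin n))
    (hD : ∀ i, partialDeriv i D = 0)
    (ho : ∀ w ∈ ((FreeAlgebra.basisFreeMonoid ℝ (Fin n)).repr D).support,
      w.toList.Pairwise (· ≤ ·)) (i : Fin n) (v : List (Fin n)) :
    (FreeAlgebra.basisFreeMonoid ℝ (Fin n)).repr D (FreeMonoid.ofList (i :: v)) = 0 := by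
  by_contra hne
  have hs := ho _ (Finsupp.mem_support_iff.2 hne)
  have key : ∀ w ∈ ((FreeAlgebra.basisFreeMonoid ℝ (Fin n)).repr D).support,
      w ≠ FreeMonoid.ofList (i :: v) →
      (FreeAlgebra.basisFreeMonoid ℝ (Fin n)).repr (partialDeriv i (monomial w))
        (FreeMonoid.ofList v) = 0 := by
    intro w hw hwne
    rw [partialDeriv_monomial, map_sum, Finsupp.finsetSum_apply]
    refine Finset.sum_eq_zero fun j _ => ?_
    split_ifs with hj
    · rw [monomial, Module.Basis.repr_self, Finsupp.single_apply, if_neg]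
      intro he
      exact hwne (eq_of_eraseIdx_eq hs (ho w hw) j hj he)
    · simp
  have h0 := congrArg (fun Q => (FreeAlgebra.basisFreeMonoid ℝ (Fin n)).repr Q
    (FreeMonoid.ofList v)) (hD i)
  have hsum := (FreeAlgebra.basisFreeMonoid ℝ (Fin n)).linearCombination_repr D
  rw [Finsupp.linearCombination_apply, Finsupp.sum] at hsum
  rw [← hsum] at h0
  simp only [map_sum, map_smul, Finsupp.finsetSum_apply, Finsupp.smul_apply, map_zero,
    Finsupp.coe_zero, Pi.zero_apply] at h0
  rw [Finset.sum_eq_single (FreeMonoid.ofList (i :: v))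
    (fun w hw hwne => by rw [key w hw hwne, smul_zero])
    (fun h => absurd (Finsupp.mem_support_iff.2 hne) h)] at h0
  refine (mul_ne_zero hne ?_) h0
  rw [partialDeriv_monomial, map_sum, Finsupp.finsetSum_apply]
  refine ne_of_gt (Finset.sum_pos' (fun j _ => ?_) ⟨⟨0, Nat.succ_pos _⟩, Finset.mem_univ _, ?_⟩)
  · split_ifs
    · rw [monomial, Module.Basis.repr_self, Finsupp.single_apply]
      split_ifs <;> norm_num
    · simp
  · have h1 : (FreeAlgebra.basisFreeMonoid ℝ (Fin n)).repr (monomial (FreeMonoid.ofList v))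
        (FreeMonoid.ofList v) = 1 := by
      rw [monomial, Module.Basis.repr_self, Finsupp.single_eq_same]
    exact lt_of_lt_of_eq one_pos (h1.symm.trans
      (congrArg (fun Q => (FreeAlgebra.basisFreeMonoid ℝ (Fin n)).repr Q (FreeMonoid.ofList v))
        (if_pos rfl).symm))

theorem isFreeAppellFamily_unique (φ : A →ₗ[ℝ] ℝ) (hφ : φ 1 = 1)
    {P Q : ∀ n : ℕ, (Fin n → A) → FreeAlgebra ℝ (Fin n)}
    (hP : IsFreeAppellFamily φ P) (hQ : IsFreeAppellFamily φ Q) : P = Q := by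
  funext n
  induction n using Nat.strong_induction_on with
  | _ n ih =>
    funext X
    rcases Nat.eq_zero_or_pos n with rfl | hn
    · rw [hP.empty, hQ.empty]
    have hD : ∀ i, partialDeriv i (P n X - Q n X) = 0 := fun i => by
      have hi := i.2
      rw [map_sub, hP.deriv, hQ.deriv, ih i hi, ih (n - (i + 1)) (by omega), sub_self]
    have ho : ∀ w ∈ ((FreeAlgebra.basisFreeMonoid ℝ (Fin n)).repr (P n X - Q n X)).support,
        w.toList.Pairwise (· ≤ ·) := fun w hw => by
      classical
      rw [map_sub] at hw
      rcases Finset.mem_union.1 (Finsupp.support_sub hw) with h | h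
      · exact hP.ordered n X w h
      · exact hQ.ordered n X w h
    have hz := repr_eq_zero_of_partialDeriv _ hD ho
    set r := (FreeAlgebra.basisFreeMonoid ℝ (Fin n)).repr (P n X - Q n X) 1 with hr
    have hconst : P n X - Q n X = r • 1 := by
      apply (FreeAlgebra.basisFreeMonoid ℝ (Fin n)).repr.injective
      ext w
      rw [← monomial_one, map_smul, monomial, Module.Basis.repr_self]
      cases hw : w.toList with
      | nil =>
        have : w = 1 := hw
        subst this
        simp [hr]
      | cons i v =>
        have : w = FreeMonoid.ofList (i :: v) := hw
        rw [this, hz i v, Finsupp.smul_apply, Finsupp.single_eq_of_ne, smul_zero]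
        exact fun h => absurd (congrArg FreeMonoid.toList h) (List.cons_ne_nil i v)
    have hr0 : r = 0 := by
      have h := congrArg (fun T => φ (evalAt X T)) hconst
      simpa [hP.centered n X hn, hQ.centered n X hn, hφ] using h.symm
    rw [hr0, zero_smul] at hconst
    exact sub_eq_zero.1 hconst

theorem existsUnique_isFreeAppellFamily (φ : A →ₗ[ℝ] ℝ) (hφ : φ 1 = 1) :
    ∃! P : ∀ n : ℕ, (Fin n → A) → FreeAlgebra ℝ (Fin n), IsFreeAppellFamily φ P :=
  ⟨recP φ, isFreeAppellFamily_recP φ hφ, fun _ h =>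
    isFreeAppellFamily_unique φ hφ h (isFreeAppellFamily_recP φ hφ)⟩

theorem isFreeAppellFamily_freeAppellPoly (φ : A →ₗ[ℝ] ℝ) (hφ : φ 1 = 1) :
    IsFreeAppellFamily φ (fun _ X => freeAppellPoly φ X) :=
  Classical.epsilon_spec (existsUnique_isFreeAppellFamily φ hφ).exists

end ExistsUnique

end FreeAppell

end

open FreeAppell

open scoped Classical

/-! The basic object is the multiplicative sum `ncSum w S` over the non-crossing partitions of a
finite set `S` of natural numbers. For `w` the free cumulants it is the moment of the product over
`S` (`apply_prodOn`). Conversely, weights whose sums give the moments over all subsets of `K` are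
the cumulants on the nonempty subsets, since the one-class partition isolates the weight of the full
set and all other classes are smaller (`eq_cumulantOn`).

Appell polynomials. By uniqueness they satisfy A[Y_b,…,Y_{b+m}] = Y_b A[Y_{b+1},…,Y_{b+m}] - ∑_{k ≤
m} c_k A[Y_{b+k+1},…,Y_{b+m}] with c_k = φ(Y_b A[Y_{b+1},…,Y_{b+k}]). Let a product mix plain
variables with Appell polynomials. Its moment is the sum over the non-crossing partitions having no
class inside the index interval of an Appell factor (`Segment.apply_prod_value`). The proof is by
induction on the number of variables in Appell factors. In the first term of the recursion b has
become plain, so only classes inside (b, b+m] are forbidden, and the partitions whose class of b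
lies in [b, b+m] are in excess. Such a class is an initial interval [b, b+k]: over a gap, a class
would be trapped inside (b, b+m], which is forbidden. Deleting it leaves the k-th subtracted term
(`ncSum_extend_interval`). The same induction shows c_k = R[Y_b,…,Y_{b+k}].

Cumulants. Link two blocks of σ when a class of π meets both. Positions are ordered compatibly with
block indices, so the connected components form a non-crossing partition τ of the indices, and π
amounts to τ together with a connected non-crossing partition over each class of τ
(`ncSum_eq_ncSum_connSum`). The moments of the block elements are thus moment-cumulant sums whose
weights are connected sums, and uniqueness identifies these weights with the cumulants
(`connSum_eq_cumulantOn`). Setting weights to zero on homogeneous classes treats Appell polynomials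
and plain products alike. -/

open scoped Classical

noncomputable section

namespace FreeAppell

/-! ### Non-crossing partitions of finite sets of natural numbers -/

/-- `π` is a set partition of `S`. -/
structure IsSetPartition (S : Finset ℕ) (π : Finset (Finset ℕ)) : Prop where
  nonempty : ∀ B ∈ π, B.Nonempty
  subset : ∀ B ∈ π, B ⊆ S
  cover : ∀ x ∈ S, ∃ B ∈ π, x ∈ B
  eq_of_mem : ∀ B ∈ π, ∀ B' ∈ π, ∀ x, x ∈ B → x ∈ B' → B = B'

/-- No two distinct classes of `π` cross. -/
def NonCrossing (π : Finset (Finset ℕ)) : Prop :=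
  ∀ B ∈ π, ∀ B' ∈ π, ∀ i ∈ B, ∀ j ∈ B', ∀ k ∈ B, ∀ l ∈ B', i < j → j < k → k < l → B = B'

/-- The non-crossing partitions of a finite set of natural numbers. -/
def ncPart (S : Finset ℕ) : Finset (Finset (Finset ℕ)) :=
  {π ∈ S.powerset.powerset | IsSetPartition S π ∧ NonCrossing π}

theorem mem_ncPart {S : Finset ℕ} {π : Finset (Finset ℕ)} :
    π ∈ ncPart S ↔ IsSetPartition S π ∧ NonCrossing π := by
  rw [ncPart, Finset.mem_filter, and_iff_right_iff_imp, Finset.mem_powerset]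
  exact fun h B hB => Finset.mem_powerset.2 (h.1.subset B hB)

/-- The sum over non-crossing partitions of the product of the weights of the classes. -/
def ncSum (w : Finset ℕ → ℝ) (S : Finset ℕ) : ℝ := ∑ π ∈ ncPart S, ∏ B ∈ π, w B

theorem prod_congr_of_isSetPartition {S : Finset ℕ} {π : Finset (Finset ℕ)}
    (hπ : IsSetPartition S π) {w w' : Finset ℕ → ℝ}
    (h : ∀ B ⊆ S, B.Nonempty → w B = w' B) : ∏ B ∈ π, w B = ∏ B ∈ π, w' B :=
  Finset.prod_congr rfl fun B hB => h B (hπ.subset B hB) (hπ.nonempty B hB)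

theorem ncSum_congr {S : Finset ℕ} {w w' : Finset ℕ → ℝ}
    (h : ∀ B ⊆ S, B.Nonempty → w B = w' B) : ncSum w S = ncSum w' S :=
  Finset.sum_congr rfl fun _ hπ => prod_congr_of_isSetPartition (mem_ncPart.1 hπ).1 h

theorem ncPart_empty : ncPart ∅ = {∅} := by
  ext π
  rw [mem_ncPart, Finset.mem_singleton]
  constructor
  · rintro ⟨h, -⟩
    refine Finset.eq_empty_of_forall_notMem fun B hB => ?_
    obtain ⟨x, hx⟩ := h.nonempty B hB
    exact absurd (h.subset B hB hx) (Finset.notMem_empty x)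
  · rintro rfl
    exact ⟨⟨by simp, by simp, by simp, by simp⟩, fun B hB => absurd hB (Finset.notMem_empty B)⟩

theorem singleton_mem_ncPart {S : Finset ℕ} (hS : S.Nonempty) : {S} ∈ ncPart S := by
  rw [mem_ncPart]
  refine ⟨⟨by simpa using hS, by simp, fun x hx => ⟨S, by simp, hx⟩, by simp⟩, ?_⟩
  intro B hB B' hB' _ _ _ _ _ _ _ _ _ _ _
  rw [Finset.mem_singleton.1 hB, Finset.mem_singleton.1 hB']

theorem IsSetPartition.eq_singleton {S : Finset ℕ} {π : Finset (Finset ℕ)}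
    (hπ : IsSetPartition S π) (h : S ∈ π) : π = {S} := by
  ext B
  rw [Finset.mem_singleton]
  constructor
  · intro hB
    obtain ⟨x, hx⟩ := hπ.nonempty B hB
    exact hπ.eq_of_mem B hB S h x hx (hπ.subset B hB hx)
  · rintro rfl
    exact h

/-- Removing a class `B` which is an interval of `S`. -/
theorem sum_ncPart_mem {S B : Finset ℕ} (hB : B.Nonempty) (hBS : B ⊆ S)
    (hI : ∀ x ∈ B, ∀ z ∈ B, ∀ y ∈ S, x < y → y < z → y ∈ B) (w : Finset ℕ → ℝ) :
    ∑ π ∈ ncPart S with B ∈ π, ∏ C ∈ π, w C = w B * ncSum w (S \ B) := by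
  rw [ncSum, Finset.mul_sum]
  have hnot : ∀ π ∈ ncPart (S \ B), B ∉ π := fun π hπ h => by
    obtain ⟨x, hx⟩ := hB
    exact (Finset.mem_sdiff.1 ((mem_ncPart.1 hπ).1.subset B h hx)).2 hx
  refine Finset.sum_bij' (fun π _ => π.erase B) (fun π _ => insert B π) ?_ ?_ ?_ ?_ ?_
  · intro π hπ
    rw [Finset.mem_filter, mem_ncPart] at hπ
    obtain ⟨⟨h1, h2⟩, h3⟩ := hπ
    rw [mem_ncPart]
    refine ⟨⟨fun C hC => h1.nonempty C (Finset.mem_of_mem_erase hC), fun C hC x hx => ?_,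
      fun x hx => ?_, fun C hC C' hC' => h1.eq_of_mem C (Finset.mem_of_mem_erase hC) C'
        (Finset.mem_of_mem_erase hC')⟩, fun C hC C' hC' => h2 C (Finset.mem_of_mem_erase hC) C'
        (Finset.mem_of_mem_erase hC')⟩
    · refine Finset.mem_sdiff.2 ⟨h1.subset C (Finset.mem_of_mem_erase hC) hx, fun hxB => ?_⟩
      exact Finset.ne_of_mem_erase hC (h1.eq_of_mem C (Finset.mem_of_mem_erase hC) B h3 x hx hxB)
    · rw [Finset.mem_sdiff] at hx
      obtain ⟨C, hC, hxC⟩ := h1.cover x hx.1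
      refine ⟨C, Finset.mem_erase.2 ⟨?_, hC⟩, hxC⟩
      rintro rfl
      exact hx.2 hxC
  · intro π hπ
    have hn := hnot π hπ
    rw [mem_ncPart] at hπ
    obtain ⟨h1, h2⟩ := hπ
    have hd : ∀ C ∈ π, ∀ x, x ∈ C → x ∉ B := fun C hC x hx =>
      (Finset.mem_sdiff.1 (h1.subset C hC hx)).2
    have hs : ∀ C ∈ π, C ⊆ S := fun C hC => (h1.subset C hC).trans Finset.sdiff_subset
    rw [Finset.mem_filter, mem_ncPart]
    refine ⟨⟨⟨?_, ?_, ?_, ?_⟩, ?_⟩, Finset.mem_insert_self _ _⟩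
    · intro C hC
      rcases Finset.mem_insert.1 hC with rfl | hC
      · exact hB
      · exact h1.nonempty C hC
    · intro C hC
      rcases Finset.mem_insert.1 hC with rfl | hC
      · exact hBS
      · exact hs C hC
    · intro x hx
      by_cases hxB : x ∈ B
      · exact ⟨B, Finset.mem_insert_self _ _, hxB⟩
      · obtain ⟨C, hC, hxC⟩ := h1.cover x (Finset.mem_sdiff.2 ⟨hx, hxB⟩)
        exact ⟨C, Finset.mem_insert_of_mem hC, hxC⟩
    · intro C hC C' hC' x hx hx'
      rcases Finset.mem_insert.1 hC with rfl | h3 <;>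
        rcases Finset.mem_insert.1 hC' with rfl | h4
      · rfl
      · exact absurd hx (hd C' h4 x hx')
      · exact absurd hx' (hd C h3 x hx)
      · exact h1.eq_of_mem C h3 C' h4 x hx hx'
    -- A crossing with `B` would put a point of the other class between two points of `B`, hence
    -- into `B`.
    · intro C hC C' hC' i hi j hj k hk l hl hij hjk hkl
      rcases Finset.mem_insert.1 hC with rfl | h3 <;>
        rcases Finset.mem_insert.1 hC' with rfl | h4
      · rfl
      · exact absurd (hI i hi k hk j (hs C' h4 hj) hij hjk) (hd C' h4 j hj)
      · exact absurd (hI j hj l hl k (hs C h3 hk) hjk hkl) (hd C h3 k hk)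
      · exact h2 C h3 C' h4 i hi j hj k hk l hl hij hjk hkl
  · intro π hπ
    exact Finset.insert_erase (Finset.mem_filter.1 hπ).2
  · intro π hπ
    exact Finset.erase_insert (hnot π hπ)
  · intro π hπ
    rw [Finset.mul_prod_erase _ _ (Finset.mem_filter.1 hπ).2]

/-! ### Transport from `Fin n` -/

/-- The image of a partition of `Fin n` under an embedding. -/
def mapParts {n : ℕ} (e : Fin n ↪o ℕ) (π : Part n) : Finset (Finset ℕ) :=
  π.parts.image (Finset.map e.toEmbedding)

theorem mem_mapParts {n : ℕ} {e : Fin n ↪o ℕ} {π : Part n} {C : Finset ℕ} :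
    C ∈ mapParts e π ↔ ∃ B ∈ π.parts, B.map e.toEmbedding = C := Finset.mem_image

theorem mapParts_injective {n : ℕ} (e : Fin n ↪o ℕ) : Function.Injective (mapParts e) :=
  fun _ _ h => Finpartition.ext (Finset.image_injective (Finset.map_injective _) h)

theorem Part.eq_of_mem {n : ℕ} (π : Part n) {B C : Finset (Fin n)} (hB : B ∈ π.parts)
    (hC : C ∈ π.parts) {x : Fin n} (hx : x ∈ B) (hx' : x ∈ C) : B = C :=
  π.disjoint.elim_finset hB hC x hx hx'

theorem isSetPartition_mapParts {n : ℕ} (e : Fin n ↪o ℕ) (π : Part n) :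
    IsSetPartition (Finset.univ.map e.toEmbedding) (mapParts e π) where
  nonempty := by
    intro C hC
    obtain ⟨B, hB, rfl⟩ := mem_mapParts.1 hC
    exact (π.nonempty_of_mem_parts hB).map
  subset := by
    intro C hC
    obtain ⟨B, hB, rfl⟩ := mem_mapParts.1 hC
    exact Finset.map_subset_map.2 (Finset.subset_univ B)
  cover := by
    intro x hx
    obtain ⟨y, hy, rfl⟩ := Finset.mem_map.1 hx
    obtain ⟨B, hB, hyB⟩ := π.exists_mem hy
    exact ⟨_, mem_mapParts.2 ⟨B, hB, rfl⟩, Finset.mem_map_of_mem _ hyB⟩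
  eq_of_mem := by
    intro C hC C' hC' x hx hx'
    obtain ⟨B, hB, rfl⟩ := mem_mapParts.1 hC
    obtain ⟨B', hB', rfl⟩ := mem_mapParts.1 hC'
    obtain ⟨y, hy, rfl⟩ := Finset.mem_map.1 hx
    rw [π.eq_of_mem hB hB' hy ((Finset.mem_map' _).1 hx')]

/-- In the definition on `Fin n`, distinct classes already exclude `l = i` and `l = k`. The cases `l
< i` and `k < l` are the two crossing patterns, with the roles of the classes exchanged in the
first. -/
theorem nonCrossing_mapParts {n : ℕ} (e : Fin n ↪o ℕ) (π : Part n) :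
    NonCrossing (mapParts e π) ↔ IsNonCrossing π := by
  constructor
  · intro h i j k l hij hjk ⟨B, hB, hi, hk⟩ ⟨C, hC, hj, hl⟩ hn
    have hBC : B ≠ C := by
      rintro rfl
      exact hn ⟨B, hB, hi, hj⟩
    have hd : ∀ {x y : Fin n}, x ∈ B → y ∈ C → x ≠ y := by
      rintro x _ hx hy rfl
      exact hBC (π.eq_of_mem hB hC hx hy)
    have hmB : B.map e.toEmbedding ∈ mapParts e π := mem_mapParts.2 ⟨B, hB, rfl⟩
    have hmC : C.map e.toEmbedding ∈ mapParts e π := mem_mapParts.2 ⟨C, hC, rfl⟩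
    have hm : ∀ {x : Fin n} {D : Finset (Fin n)}, x ∈ D → e x ∈ D.map e.toEmbedding :=
      fun hx => Finset.mem_map_of_mem _ hx
    constructor
    · by_contra hli
      have hli : l < i := lt_of_le_of_ne (not_lt.1 hli) (hd hi hl).symm
      exact hBC (Finset.map_injective _ (h _ hmC _ hmB _ (hm hl) _ (hm hi) _ (hm hj) _ (hm hk)
        (e.strictMono hli) (e.strictMono hij) (e.strictMono hjk))).symm
    · by_contra hkl
      have hkl : k < l := lt_of_le_of_ne (not_lt.1 hkl) (hd hk hl)
      exact hBC (Finset.map_injective _ (h _ hmB _ hmC _ (hm hi) _ (hm hj) _ (hm hk) _ (hm hl)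
        (e.strictMono hij) (e.strictMono hjk) (e.strictMono hkl)))
  · intro h B' hB' C' hC' i' hi' j' hj' k' hk' l' hl' hij hjk hkl
    obtain ⟨B, hB, rfl⟩ := mem_mapParts.1 hB'
    obtain ⟨C, hC, rfl⟩ := mem_mapParts.1 hC'
    obtain ⟨i, hi, rfl⟩ := Finset.mem_map.1 hi'
    obtain ⟨j, hj, rfl⟩ := Finset.mem_map.1 hj'
    obtain ⟨k, hk, rfl⟩ := Finset.mem_map.1 hk'
    obtain ⟨l, hl, rfl⟩ := Finset.mem_map.1 hl'
    have hij := e.lt_iff_lt.1 hij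
    have hjk := e.lt_iff_lt.1 hjk
    have hkl := e.lt_iff_lt.1 hkl
    by_contra hne
    refine absurd (h i j k l hij hjk ⟨B, hB, hi, hk⟩ ⟨C, hC, hj, hl⟩ ?_).2 (not_lt_of_gt hkl)
    rintro ⟨D, hD, hiD, hjD⟩
    rw [π.eq_of_mem hB hD hi hiD, π.eq_of_mem hC hD hj hjD] at hne
    exact hne rfl

theorem exists_mapParts_eq {n : ℕ} (e : Fin n ↪o ℕ) {ρ : Finset (Finset ℕ)}
    (hρ : IsSetPartition (Finset.univ.map e.toEmbedding) ρ) : ∃ π : Part n, mapParts e π = ρ := by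
  have hmap : ∀ B ∈ ρ,
      (Finset.univ.filter fun x : Fin n => e x ∈ B).map e.toEmbedding = B := by
    intro B hB
    ext y
    simp only [Finset.mem_map, Finset.mem_filter, Finset.mem_univ, true_and]
    constructor
    · rintro ⟨x, hx, rfl⟩
      exact hx
    · intro hy
      obtain ⟨x, -, rfl⟩ := Finset.mem_map.1 (hρ.subset B hB hy)
      exact ⟨x, hy, rfl⟩
  refine ⟨Finpartition.ofExistsUnique
    (ρ.image fun B => Finset.univ.filter fun x : Fin n => e x ∈ B) ?_ ?_ ?_, ?_⟩
  · exact fun p _ => Finset.subset_univ p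
  · intro x _
    obtain ⟨B, hB, hx⟩ := hρ.cover (e x) (Finset.mem_map_of_mem _ (Finset.mem_univ x))
    refine ⟨Finset.univ.filter fun x : Fin n => e x ∈ B,
      ⟨Finset.mem_image_of_mem _ hB, by simpa using hx⟩, ?_⟩
    rintro D ⟨hD, hxD⟩
    obtain ⟨B', hB', rfl⟩ := Finset.mem_image.1 hD
    rw [hρ.eq_of_mem B hB B' hB' (e x) hx (by simpa using hxD)]
  · intro h
    obtain ⟨B, hB, hB0⟩ := Finset.mem_image.1 h
    have := hmap B hB
    rw [hB0, Finset.map_empty] at this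
    exact absurd (hρ.nonempty B hB) (by simp [← this])
  · ext B
    rw [mem_mapParts]
    simp only [Finpartition.ofExistsUnique, Finset.mem_image]
    constructor
    · rintro ⟨_, ⟨B', hB', rfl⟩, rfl⟩
      rwa [hmap B' hB']
    · exact fun hB => ⟨_, ⟨B, hB, rfl⟩, hmap B hB⟩

/-- The predicate is a parameter so that one bijection serves all the families of partitions: all,
non-homogeneous, connected, or both. -/
theorem sum_NC_filter_eq {n : ℕ} (e : Fin n ↪o ℕ) (P : Part n → Prop)
    (Q : Finset (Finset ℕ) → Prop) [DecidablePred P] [DecidablePred Q]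
    (hPQ : ∀ π, P π ↔ Q (mapParts e π)) (w : Finset ℕ → ℝ) :
    ∑ π ∈ NC n with P π, ∏ B ∈ π.parts, w (B.map e.toEmbedding) =
      ∑ π ∈ ncPart (Finset.univ.map e.toEmbedding) with Q π, ∏ B ∈ π, w B := by
  refine Finset.sum_bij (fun π _ => mapParts e π) ?_ (fun _ _ _ _ h => mapParts_injective e h) ?_ ?_
  · intro π hπ
    rw [Finset.mem_filter, NC, Finset.mem_filter] at hπ
    exact Finset.mem_filter.2 ⟨mem_ncPart.2 ⟨isSetPartition_mapParts e π,
      (nonCrossing_mapParts e π).2 hπ.1.2⟩, (hPQ π).1 hπ.2⟩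
  · intro ρ hρ
    rw [Finset.mem_filter, mem_ncPart] at hρ
    obtain ⟨π, rfl⟩ := exists_mapParts_eq e hρ.1.1
    refine ⟨π, ?_, rfl⟩
    rw [Finset.mem_filter, NC, Finset.mem_filter]
    exact ⟨⟨Finset.mem_univ _, (nonCrossing_mapParts e π).1 hρ.1.2⟩, (hPQ π).2 hρ.2⟩
  · intro π _
    rw [mapParts, Finset.prod_image fun _ _ _ _ h => Finset.map_injective _ h]

section MomentCumulant

/-! ### Moments and free cumulants along finite sets of indices -/

variable {A : Type*} [Ring A]

/-- The product of `Y_x`, `x ∈ S`, in increasing order. -/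
def prodOn (Y : ℕ → A) (S : Finset ℕ) : A := (S.sort.map Y).prod

theorem prodOn_empty (Y : ℕ → A) : prodOn Y ∅ = 1 := by simp [prodOn]

theorem orderedProd_comp (Y : ℕ → A) {n : ℕ} (e : Fin n ↪o ℕ) :
    orderedProd (fun j => Y (e j)) = prodOn Y (Finset.univ.map e.toEmbedding) := by
  rw [orderedProd, prodOn]
  congr 1
  have hmem : ∀ j, e j ∈ Finset.univ.map e.toEmbedding := fun j =>
    Finset.mem_map_of_mem _ (Finset.mem_univ j)
  have hcard : (Finset.univ.map e.toEmbedding).card = n := by simp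
  -- With the image replaced by a variable `S`, the length can be replaced by `S.card`; the
  -- increasing enumeration of `S` is unique.
  generalize Finset.univ.map e.toEmbedding = S at hmem hcard
  subst hcard
  rw [Finset.orderEmbOfFin_unique' rfl hmem, ← Finset.listMap_orderEmbOfFin_finRange S rfl,
    List.map_map, List.ofFn_eq_map]
  rfl

variable [Algebra ℝ A]

/-- The free cumulant of `Y_x`, `x ∈ S`, in increasing order. -/
def cumulantOn (φ : A →ₗ[ℝ] ℝ) (Y : ℕ → A) (S : Finset ℕ) : ℝ :=
  freeCumulant φ fun j : Fin S.card => Y (S.orderEmbOfFin rfl j)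

/-- The increasing enumeration of a finite set is unique, so the cumulant depends only on the image
of `e`. Cumulants thereby become functions of finite sets, free of dependent lengths. -/
theorem freeCumulant_comp (φ : A →ₗ[ℝ] ℝ) (Y : ℕ → A) {n : ℕ} (e : Fin n ↪o ℕ) :
    freeCumulant φ (fun j => Y (e j)) = cumulantOn φ Y (Finset.univ.map e.toEmbedding) := by
  have hmem : ∀ j, e j ∈ Finset.univ.map e.toEmbedding := fun j =>
    Finset.mem_map_of_mem _ (Finset.mem_univ j)
  have hcard : (Finset.univ.map e.toEmbedding).card = n := by simp
  generalize Finset.univ.map e.toEmbedding = S at hmem hcard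
  subst hcard
  rw [cumulantOn, Finset.orderEmbOfFin_unique' rfl hmem]

theorem freeCumulant_subtuple (φ : A →ₗ[ℝ] ℝ) (Y : ℕ → A) {n : ℕ} (e : Fin n ↪o ℕ)
    (B : Finset (Fin n)) :
    freeCumulant φ (subtuple (fun j => Y (e j)) B) = cumulantOn φ Y (B.map e.toEmbedding) := by
  refine (freeCumulant_comp φ Y ((B.orderEmbOfFin rfl).trans e)).trans ?_
  congr 1
  conv_rhs => rw [← B.map_orderEmbOfFin_univ rfl, Finset.map_map]
  rfl

theorem partCumulant_comp (φ : A →ₗ[ℝ] ℝ) (Y : ℕ → A) {n : ℕ} (e : Fin n ↪o ℕ) (π : Part n) :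
    partCumulant φ π (fun j => Y (e j)) =
      ∏ B ∈ π.parts, cumulantOn φ Y (B.map e.toEmbedding) :=
  Finset.prod_congr rfl fun B _ => freeCumulant_subtuple φ Y e B

/-- This is the defining recursion with the term of `⊤` moved to the other side. Positivity of `n`
is needed for `⊤` to have the class `Finset.univ`: for `n = 0` it has no class and its product is
one, while the moment is `φ 1`. -/
theorem jointMoment_eq_sum (φ : A →ₗ[ℝ] ℝ) {n : ℕ} (X : Fin n → A) (hn : 0 < n) :
    jointMoment φ X = ∑ π ∈ NC n, partCumulant φ π X := by
  have htop : (⊤ : Part n) ∈ NC n := by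
    refine Finset.mem_filter.2 ⟨Finset.mem_univ _, fun i j k l _ _ _ _ h => absurd ?_ h⟩
    obtain ⟨B, hB, hi⟩ := (⊤ : Part n).exists_mem (Finset.mem_univ i)
    obtain ⟨C, hC, hj⟩ := (⊤ : Part n).exists_mem (Finset.mem_univ j)
    have h1 := Finset.mem_singleton.1 (Finpartition.parts_top_subset _ hB)
    have h2 := Finset.mem_singleton.1 (Finpartition.parts_top_subset _ hC)
    exact ⟨B, hB, hi, by rw [h1, ← h2]; exact hj⟩
  have hpc : partCumulant φ ⊤ X = freeCumulant φ X := by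
    have : (⊤ : Part n).parts = {Finset.univ} := by
      have : Nonempty (Fin n) := ⟨⟨0, hn⟩⟩
      refine (Finset.subset_singleton_iff.1 (Finpartition.parts_top_subset _)).resolve_left ?_
      exact ((⊤ : Part n).parts_nonempty Finset.univ_nonempty.ne_empty).ne_empty
    rw [partCumulant, this, Finset.prod_singleton]
    have h := freeCumulant_subtuple φ (ext0 X) (Fin.valOrderEmb n) Finset.univ
    rw [← freeCumulant_comp] at h
    simpa [ext0] using h
  rw [← Finset.add_sum_erase _ _ htop, hpc, freeCumulant_eq, Finset.filter_ne']
  simp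

theorem ncSum_empty (w : Finset ℕ → ℝ) : ncSum w ∅ = 1 := by simp [ncSum, ncPart_empty]

/-- The free moment-cumulant formula. -/
theorem apply_prodOn (φ : A →ₗ[ℝ] ℝ) (hφ : φ 1 = 1) (Y : ℕ → A) (S : Finset ℕ) :
    φ (prodOn Y S) = ncSum (cumulantOn φ Y) S := by
  rcases S.eq_empty_or_nonempty with rfl | hS
  · rw [prodOn_empty, hφ, ncSum_empty]
  have h := jointMoment_eq_sum φ (fun j => Y (S.orderEmbOfFin rfl j)) hS.card_pos
  rw [jointMoment, orderedProd_comp, Finset.map_orderEmbOfFin_univ] at h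
  rw [h, ncSum]
  simp only [partCumulant_comp]
  have := sum_NC_filter_eq (S.orderEmbOfFin rfl) (fun _ => True) (fun _ => True) (fun _ => Iff.rfl)
    (cumulantOn φ Y)
  rw [Finset.map_orderEmbOfFin_univ] at this
  simpa using this

/-- Weights which satisfy the moment-cumulant formula are the free cumulants. -/
theorem eq_cumulantOn (φ : A →ₗ[ℝ] ℝ) (hφ : φ 1 = 1) (Y : ℕ → A) (r : Finset ℕ → ℝ)
    (K : Finset ℕ) (h : ∀ T ⊆ K, φ (prodOn Y T) = ncSum r T) :
    ∀ T ⊆ K, T.Nonempty → r T = cumulantOn φ Y T := by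
  intro T
  induction T using Finset.strongInduction with
  | _ T ih =>
    intro hTK hT
    have h1 := (h T hTK).symm.trans (apply_prodOn φ hφ Y T)
    -- The one-class partition contributes the weight of `T` itself; every other partition has only
    -- proper subsets of `T` as classes, where the induction hypothesis applies.
    rw [ncSum, ncSum, ← Finset.add_sum_erase _ _ (singleton_mem_ncPart hT),
      ← Finset.add_sum_erase _ _ (singleton_mem_ncPart hT), Finset.prod_singleton,
      Finset.prod_singleton] at h1
    refine add_right_cancel (h1.trans ?_)
    congr 1
    refine (Finset.sum_congr rfl fun π hπ => Finset.prod_congr rfl fun B hB => ?_).symm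
    obtain ⟨hne, hπ⟩ := Finset.mem_erase.1 hπ
    have hp := (mem_ncPart.1 hπ).1
    refine ih B ((hp.subset B hB).ssubset_of_ne ?_) ((hp.subset B hB).trans hTK) (hp.nonempty B hB)
    rintro rfl
    exact hne (hp.eq_singleton hB)

theorem cumulantOn_empty (φ : A →ₗ[ℝ] ℝ) (hφ : φ 1 = 1) (Y : ℕ → A) : cumulantOn φ Y ∅ = 1 := by
  have hn : ∀ n : ℕ, ∀ X : Fin n → A, n = 0 → freeCumulant φ X = 1 := by
    rintro _ X rfl
    rw [freeCumulant_eq, jointMoment, orderedProd, List.ofFn_zero, List.prod_nil, hφ,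
      Finset.sum_eq_zero, sub_zero]
    -- On no points `⊤` is the only partition, so the recursion reduces to `φ 1`.
    intro π hπ
    refine absurd (le_antisymm le_top ?_) (Finset.mem_filter.1 hπ).2
    intro B hB
    obtain ⟨x, -⟩ := (⊤ : Part 0).nonempty_of_mem_parts hB
    exact x.elim0
  exact hn _ _ Finset.card_empty

end MomentCumulant

/-! ### Moments of products of free Appell polynomials -/

theorem prodOn_union {A : Type*} [Ring A] (Y : ℕ → A) {S T : Finset ℕ}
    (h : ∀ x ∈ S, ∀ y ∈ T, x < y) : prodOn Y (S ∪ T) = prodOn Y S * prodOn Y T := by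
  have : (S ∪ T).sort = S.sort ++ T.sort := by
    refine List.Perm.eq_of_pairwise (le := (· ≤ ·)) (fun a b _ _ => le_antisymm)
      (Finset.pairwise_sort _ _) ?_ ?_
    · rw [List.pairwise_append]
      exact ⟨Finset.pairwise_sort _ _, Finset.pairwise_sort _ _, fun a ha b hb =>
        (h a ((Finset.mem_sort _).1 ha) b ((Finset.mem_sort _).1 hb)).le⟩
    · rw [List.perm_ext_iff_of_nodup (Finset.sort_nodup _ _)]
      · simp
      · refine List.nodup_append.2 ⟨Finset.sort_nodup _ _, Finset.sort_nodup _ _,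
          fun a ha b hb => ?_⟩
        exact (h a ((Finset.mem_sort _).1 ha) b ((Finset.mem_sort _).1 hb)).ne
  rw [prodOn, this, List.map_append, List.prod_append, prodOn, prodOn]

theorem prodOn_singleton {A : Type*} [Ring A] (Y : ℕ → A) (b : ℕ) : prodOn Y {b} = Y b := by
  simp [prodOn]

theorem prodOn_insert {A : Type*} [Ring A] (Y : ℕ → A) {S : Finset ℕ} {b : ℕ}
    (h : ∀ x ∈ S, x < b) : prodOn Y (insert b S) = prodOn Y S * Y b := by
  rw [Finset.insert_eq, Finset.union_comm, prodOn_union, prodOn_singleton]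
  simpa using h

/-- Any partition other than the one-class one has a class avoiding `b`, and this class has weight
zero. -/
theorem ncSum_eq_single {S : Finset ℕ} {b : ℕ} (hb : b ∈ S) (w : Finset ℕ → ℝ)
    (hw : ∀ B ⊆ S, B.Nonempty → b ∉ B → w B = 0) : ncSum w S = w S := by
  rw [ncSum, Finset.sum_eq_single_of_mem _ (singleton_mem_ncPart ⟨b, hb⟩), Finset.prod_singleton]
  intro π hπ hne
  have hp := (mem_ncPart.1 hπ).1
  obtain ⟨B, hB, hbB⟩ := hp.cover b hb
  by_cases h : ∃ C ∈ π, b ∉ C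
  · obtain ⟨C, hC, hbC⟩ := h
    exact Finset.prod_eq_zero hC (hw C (hp.subset C hC) (hp.nonempty C hC) hbC)
  · push Not at h
    refine absurd (hp.eq_singleton ?_) hne
    have : S = B := by
      refine Finset.Subset.antisymm (fun x hx => ?_) (hp.subset B hB)
      obtain ⟨C, hC, hxC⟩ := hp.cover x hx
      rwa [hp.eq_of_mem B hB C hC b hbB (h C hC)]
    rwa [this]

/-- Extending by one point an interval `(b, b + m]` whose subsets have weight zero. -/
theorem ncSum_extend_interval {S : Finset ℕ} {b m : ℕ} (hJ : Finset.Ico b (b + (m + 1)) ⊆ S)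
    (w : Finset ℕ → ℝ)
    (hw : ∀ B ⊆ Finset.Ico (b + 1) (b + 1 + m), B.Nonempty → w B = 0) :
    ncSum (fun B => if B ⊆ Finset.Ico b (b + (m + 1)) then 0 else w B) S =
      ncSum w S - ∑ k : Fin (m + 1), w (Finset.Ico b (b + k + 1)) *
        ncSum w (S \ Finset.Ico b (b + k + 1)) := by
  have hbJ : b ∈ Finset.Ico b (b + (m + 1)) := by simp
  have hk : ∀ k : Fin (m + 1), Finset.Ico b (b + k + 1) ⊆ Finset.Ico b (b + (m + 1)) := fun k =>
    Finset.Ico_subset_Ico_right (by omega)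
  have hbk : ∀ k : Fin (m + 1), b ∈ Finset.Ico b (b + k + 1) := fun k => by simp
  -- Each subtracted product counts the partitions of `S` having the interval from `b` to `b + k` as
  -- a class, so the identity can be checked partition by partition.
  have h1 : ∀ k : Fin (m + 1), w (Finset.Ico b (b + k + 1)) *
        ncSum w (S \ Finset.Ico b (b + k + 1)) =
      ∑ π ∈ ncPart S, if Finset.Ico b (b + k + 1) ∈ π then ∏ C ∈ π, w C else 0 := by
    intro k
    rw [← sum_ncPart_mem ⟨b, hbk k⟩ ((hk k).trans hJ), Finset.sum_filter]
    intro x hx z hz y _ hxy hyz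
    rw [Finset.mem_Ico] at *
    omega
  rw [Finset.sum_congr rfl fun k _ => h1 k, Finset.sum_comm, ncSum, ncSum,
    ← Finset.sum_sub_distrib]
  refine Finset.sum_congr rfl fun π hπ => ?_
  obtain ⟨hp, hnc⟩ := mem_ncPart.1 hπ
  obtain ⟨B, hB, hbB⟩ := hp.cover b (hJ hbJ)
  -- Only the class `B` of `b` can have its weight changed: any other class inside the enlarged
  -- interval misses `b` and already has weight zero.
  have hz : ∀ C ∈ π, C ≠ B → C ⊆ Finset.Ico b (b + (m + 1)) → w C = 0 := by
    intro C hC hCB hCJ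
    refine hw C (fun x hx => ?_) (hp.nonempty C hC)
    have h2 := Finset.mem_Ico.1 (hCJ hx)
    have h3 : x ≠ b := by
      rintro rfl
      exact hCB (hp.eq_of_mem C hC B hB x hx hbB)
    rw [Finset.mem_Ico]
    omega
  have hBk : ∀ k : Fin (m + 1), Finset.Ico b (b + k + 1) ∈ π → Finset.Ico b (b + k + 1) = B :=
    fun k h => hp.eq_of_mem _ h B hB b (hbk k) hbB
  by_cases hBJ : B ⊆ Finset.Ico b (b + (m + 1))
  · have hzero : ∏ C ∈ π, (if C ⊆ Finset.Ico b (b + (m + 1)) then (0 : ℝ) else w C) = 0 :=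
      Finset.prod_eq_zero hB (if_pos hBJ)
    rw [hzero]
    by_cases h0 : ∏ C ∈ π, w C = 0
    · simp [h0]
    -- If the product does not vanish, `B` has no gap. The class of a missing point below `max B`
    -- cannot leave the interval without crossing `B`, so its weight would be zero. Hence `k = max B
    -- - b`, and exactly one subtracted term cancels the product.
    obtain ⟨k, hkB⟩ : ∃ k : Fin (m + 1), Finset.Ico b (b + k + 1) = B := by
      have hM := B.max'_mem ⟨b, hbB⟩
      have hMJ := Finset.mem_Ico.1 (hBJ hM)
      refine ⟨⟨B.max' ⟨b, hbB⟩ - b, by omega⟩, ?_⟩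
      ext x
      rw [Finset.mem_Ico]
      constructor
      · intro hx
        dsimp only at hx
        by_contra hxB
        obtain ⟨C, hC, hxC⟩ := hp.cover x (hJ (Finset.mem_Ico.2 (by omega)))
        have hCB : C ≠ B := by
          rintro rfl
          exact hxB hxC
        have hxb : x ≠ b := fun h => hxB (h ▸ hbB)
        have hxM : x ≠ B.max' ⟨b, hbB⟩ := fun h => hxB (by rw [h]; exact hM)
        refine h0 (Finset.prod_eq_zero hC (hz C hC hCB fun y hy => ?_))
        rw [Finset.mem_Ico]
        by_contra hyJ
        rcases Nat.lt_or_ge y b with hyb | hyb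
        · exact hCB (hnc C hC B hB y hy b hbB x hxC _ hM hyb (by omega) (by omega))
        · exact hCB (hnc B hB C hC b hbB x hxC _ hM y hy (by omega) (by omega) (by omega)).symm
      · intro hx
        have h2 := Finset.mem_Ico.1 (hBJ hx)
        have h3 := B.le_max' x hx
        dsimp only
        omega
    rw [Finset.sum_eq_single_of_mem k (Finset.mem_univ k), if_pos (hkB ▸ hB), sub_self]
    intro l _ hlk
    refine if_neg fun hl => hlk ?_
    have h2 := congrArg Finset.card ((hBk l hl).trans hkB.symm)
    rw [Nat.card_Ico, Nat.card_Ico] at h2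
    exact Fin.ext (by omega)
  -- Here `B` leaves the interval: no subtracted term occurs, and the two weights agree on every
  -- class.
  · rw [Finset.sum_eq_zero fun k _ => if_neg fun h => hBJ (hBk k h ▸ hk k), sub_zero]
    refine Finset.prod_congr rfl fun C hC => ?_
    split_ifs with h
    · exact (hz C hC (fun he => hBJ (he ▸ h)) h).symm
    · rfl

/-- The product of the variables with indices in `plain` and of the free Appell polynomial in the
`len` variables with consecutive indices from `start` on. -/
structure Segment where
  plain : Finset ℕ
  start : ℕ
  len : ℕ

namespace Segment

/-- The indices of the variables of the free Appell polynomial. -/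
def interval (t : Segment) : Finset ℕ := Finset.Ico t.start (t.start + t.len)

/-- The indices of all the variables. -/
def support (t : Segment) : Finset ℕ := t.plain ∪ t.interval

variable {A : Type*} [Ring A] [Algebra ℝ A]

/-- The element of the algebra described by a segment. -/
def value (φ : A →ₗ[ℝ] ℝ) (Y : ℕ → A) (t : Segment) : A :=
  prodOn Y t.plain * recV φ Y t.len t.start

/-- The segments are well-formed and listed in increasing order. -/
def Ordered (L : List Segment) : Prop :=
  (∀ t ∈ L, ∀ x ∈ t.plain, x < t.start) ∧
    L.Pairwise fun t t' => ∀ x ∈ t.support, ∀ y ∈ t'.support, x < y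

/-- The weight `w`, made zero on the subsets of the intervals of `L`. -/
def weight (w : Finset ℕ → ℝ) (L : List Segment) (B : Finset ℕ) : ℝ :=
  if ∃ t ∈ L, B ⊆ t.interval then 0 else w B

theorem prod_value_of_len_eq_zero (φ : A →ₗ[ℝ] ℝ) (Y : ℕ → A) (L : List Segment)
    (h0 : ∀ t ∈ L, t.len = 0) (hL : Ordered L) (S : Finset ℕ)
    (hS : ∀ x, x ∈ S ↔ ∃ t ∈ L, x ∈ t.support) : (L.map (value φ Y)).prod = prodOn Y S := by
  induction L generalizing S with
  | nil =>
    have : S = ∅ := Finset.eq_empty_of_forall_notMem fun x hx => by simpa using (hS x).1 hx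
    rw [this, prodOn_empty, List.map_nil, List.prod_nil]
  | cons t L ih =>
    obtain ⟨h1, h2⟩ := hL
    rw [List.pairwise_cons] at h2
    have hlen := h0 t List.mem_cons_self
    have hs : t.support = t.plain := by simp [support, interval, hlen]
    have hS' : S = t.support ∪ S.filter fun x => ∃ t' ∈ L, x ∈ t'.support := by
      ext x
      simp only [Finset.mem_union, Finset.mem_filter, hS, List.mem_cons, exists_eq_or_imp]
      tauto
    rw [hS', prodOn_union, List.map_cons, List.prod_cons, value, hlen, recV, mul_one, hs,
      ih (fun t ht => h0 t (List.mem_cons_of_mem _ ht))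
        ⟨fun t ht => h1 t (List.mem_cons_of_mem _ ht), h2.2⟩]
    · intro x
      rw [Finset.mem_filter, and_iff_right_iff_imp, hS]
      rintro ⟨t', ht', hx⟩
      exact ⟨t', List.mem_cons_of_mem _ ht', hx⟩
    · intro x hx y hy
      obtain ⟨t', ht', hy⟩ := (Finset.mem_filter.1 hy).2
      exact h2.1 t' ht' x hx y hy

/-- Each term of the recursion replaces one segment by another with no larger support, so all
comparisons with the other segments persist. -/
theorem Ordered.replace {L₁ L₂ : List Segment} {t t' : Segment} (h : Ordered (L₁ ++ t :: L₂))
    (ht : ∀ x ∈ t'.plain, x < t'.start) (hs : t'.support ⊆ t.support) :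
    Ordered (L₁ ++ t' :: L₂) := by
  obtain ⟨h1, h2⟩ := h
  constructor
  · intro r hr
    rcases List.mem_append.1 hr with hr | hr
    · exact h1 r (List.mem_append_left _ hr)
    · rcases List.mem_cons.1 hr with rfl | hr
      · exact ht
      · exact h1 r (List.mem_append_right _ (List.mem_cons_of_mem _ hr))
  · rw [List.pairwise_append, List.pairwise_cons] at h2 ⊢
    refine ⟨h2.1, ⟨fun r hr x hx => h2.2.1.1 r hr x (hs hx), h2.2.1.2⟩, fun r hr q hq => ?_⟩
    rcases List.mem_cons.1 hq with rfl | hq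
    · exact fun x hx y hy => h2.2.2 r hr t List.mem_cons_self x hx y (hs hy)
    · exact h2.2.2 r hr q (List.mem_cons_of_mem _ hq)

/-- The moment formula for products of variables and free Appell polynomials. -/
theorem apply_prod_value (φ : A →ₗ[ℝ] ℝ) (hφ : φ 1 = 1) (Y : ℕ → A) (L : List Segment)
    (hL : Ordered L) (S : Finset ℕ) (hS : ∀ x, x ∈ S ↔ ∃ t ∈ L, x ∈ t.support) :
    φ (L.map (value φ Y)).prod = ncSum (weight (cumulantOn φ Y) L) S := by
  -- The induction is on the total number of variables in Appell factors. It covers all lists at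
  -- once, since the coefficients of the recursion are themselves moments of a shorter, one-segment
  -- list.
  induction hn : (L.map len).sum using Nat.strong_induction_on generalizing L S with
  | _ n ih =>
    subst hn
    by_cases h0 : ∀ t ∈ L, t.len = 0
    · rw [prod_value_of_len_eq_zero φ Y L h0 hL S hS, apply_prodOn φ hφ]
      refine ncSum_congr fun B _ hB => ?_
      rw [weight, if_neg]
      rintro ⟨t, ht, hBt⟩
      rw [interval, h0 t ht, add_zero, Finset.Ico_self, Finset.subset_empty] at hBt
      exact hB.ne_empty hBt
    push Not at h0
    obtain ⟨⟨F, b, m'⟩, ht, hm⟩ := h0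
    obtain ⟨m, rfl⟩ := Nat.exists_eq_succ_of_ne_zero hm
    obtain ⟨L₁, L₂, rfl⟩ := List.append_of_mem ht
    have hF : ∀ x ∈ F, x < b := hL.1 _ ht
    have hsum : ∀ r : Segment, ((L₁ ++ r :: L₂).map len).sum =
        (L₁.map len).sum + (r.len + (L₂.map len).sum) := fun r => by simp
    have hJS : Finset.Ico b (b + (m + 1)) ⊆ S := fun x hx =>
      (hS x).2 ⟨_, ht, Finset.mem_union_right _ hx⟩
    have hother : ∀ r ∈ L₁ ++ L₂, ∀ x ∈ Finset.Ico b (b + (m + 1)), x ∉ r.support := by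
      intro r hr x hx hxr
      have h2 := hL.2
      rw [List.pairwise_append, List.pairwise_cons] at h2
      have hx' : x ∈ (Segment.mk F b (m + 1)).support := Finset.mem_union_right _ hx
      rcases List.mem_append.1 hr with hr | hr
      · exact lt_irrefl x (h2.2.2 r hr _ List.mem_cons_self x hxr x hx')
      · exact lt_irrefl x (h2.2.1.1 r hr x hx' x hxr)
    have hsplit : ∀ (r : Segment) (p : Segment → Prop), (∃ q ∈ L₁ ++ r :: L₂, p q) ↔
        p r ∨ ∃ q ∈ L₁ ++ L₂, p q := by
      intro r p
      simp only [List.mem_append, List.mem_cons]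
      grind
    -- the coefficients of the recursion are free cumulants
    have hc : ∀ k : Fin (m + 1), φ (Y b * recV φ Y k (b + 1)) =
        cumulantOn φ Y (Finset.Ico b (b + k + 1)) := by
      intro k
      have h1 := ih k (by rw [hsum]; dsimp only; omega) [⟨{b}, b + 1, k⟩]
        ⟨by simp, by simp⟩ (Finset.Ico b (b + k + 1))
        (fun x => by simp [support, interval]; omega) (by simp)
      rw [List.map_singleton, List.prod_singleton, value, prodOn_singleton] at h1
      -- All subsets of the interval avoiding `b` weigh zero, so only the one-class partition
      -- survives, and it gives the cumulant.
      rw [h1, ncSum_eq_single (b := b) (by simp), weight, if_neg]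
      · simp only [List.mem_singleton, exists_eq_left, interval]
        intro h
        have := Finset.mem_Ico.1 (h (Finset.mem_Ico.2 ⟨le_refl b, by omega⟩))
        omega
      · intro B hB _ hbB
        refine if_pos ⟨_, List.mem_singleton_self _, fun x hx => ?_⟩
        have h2 := Finset.mem_Ico.1 (hB hx)
        have h3 : x ≠ b := fun h => hbB (h ▸ hx)
        exact Finset.mem_Ico.2 (by dsimp only; omega)
    -- The recursion for the Appell factor, multiplied on the left by the plain part: in the leading
    -- term `b` joins the plain variables.
    have hval : value φ Y ⟨F, b, m + 1⟩ = value φ Y ⟨insert b F, b + 1, m⟩ -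
        ∑ k : Fin (m + 1), cumulantOn φ Y (Finset.Ico b (b + k + 1)) •
          value φ Y ⟨F, b + k + 1, m - k⟩ := by
      simp only [value]
      rw [recV, prodOn_insert Y hF, mul_sub, Finset.mul_sum, mul_assoc]
      congr 1
      exact Finset.sum_congr rfl fun k _ => by rw [hc, mul_smul_comm]
    have hprod : ((L₁ ++ ⟨F, b, m + 1⟩ :: L₂).map (value φ Y)).prod =
        ((L₁ ++ ⟨insert b F, b + 1, m⟩ :: L₂).map (value φ Y)).prod -
          ∑ k : Fin (m + 1), cumulantOn φ Y (Finset.Ico b (b + k + 1)) •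
            ((L₁ ++ ⟨F, b + k + 1, m - k⟩ :: L₂).map (value φ Y)).prod := by
      simp only [List.map_append, List.map_cons, List.prod_append, List.prod_cons]
      rw [hval, sub_mul, mul_sub, Finset.sum_mul, Finset.mul_sum]
      congr 1
      exact Finset.sum_congr rfl fun k _ => by rw [smul_mul_assoc, mul_smul_comm]
    set w := weight (cumulantOn φ Y) (L₁ ++ ⟨insert b F, b + 1, m⟩ :: L₂) with hw
    have hwz : ∀ B ⊆ Finset.Ico (b + 1) (b + 1 + m), B.Nonempty → w B = 0 := fun B hB _ =>
      if_pos ((hsplit _ _).2 (Or.inl hB))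
    rw [hprod, map_sub, map_sum, ih _ (by rw [hsum, hsum]; dsimp only; omega) _
      (hL.replace ?_ ?_) S ?_ rfl]
    -- The weight for the original list is `w` made zero also on the subsets of the interval
    -- containing `b`, which is the setting of `ncSum_extend_interval`.
    · have hleft : ncSum (weight (cumulantOn φ Y) (L₁ ++ ⟨F, b, m + 1⟩ :: L₂)) S =
          ncSum (fun B => if B ⊆ Finset.Ico b (b + (m + 1)) then 0 else w B) S := by
        refine ncSum_congr fun B _ _ => ?_
        rw [hw, weight, weight]
        simp only [hsplit]
        by_cases hBJ : B ⊆ Finset.Ico b (b + (m + 1))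
        · exact (if_pos (Or.inl hBJ)).trans (if_pos hBJ).symm
        · rw [if_neg hBJ]
          refine if_congr (or_congr_left ?_) rfl rfl
          refine iff_of_false hBJ fun h => hBJ (h.trans ?_)
          exact Finset.Ico_subset_Ico (by simp) (by dsimp only; omega)
      rw [hleft, ncSum_extend_interval hJS w hwz]
      congr 1
      refine Finset.sum_congr rfl fun k _ => ?_
      have hbk : b ∈ Finset.Ico b (b + k + 1) := Finset.mem_Ico.2 (by omega)
      rw [map_smul, smul_eq_mul]
      congr 1
      -- This interval contains `b`, which lies in no Appell interval of the modified list, so its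
      -- weight is still the cumulant.
      · rw [hw, weight, if_neg]
        rw [hsplit]
        rintro (h | ⟨r, hr, h⟩)
        · have := Finset.mem_Ico.1 (h hbk)
          dsimp only at this
          omega
        · exact hother r hr b (by simp) (Finset.mem_union_right _ (h hbk))
      · rw [ih _ (by rw [hsum, hsum]; dsimp only; omega) _ (hL.replace ?_ ?_)
          (S \ Finset.Ico b (b + k + 1)) ?_ rfl]
        · refine ncSum_congr fun B hB _ => ?_
          rw [hw, weight, weight]
          simp only [hsplit]
          -- Away from the deleted class, being inside the Appell interval from `b + 1` on is the
          -- same as being inside the one from `b + k + 1` on.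
          refine if_congr (or_congr_left ⟨fun h => h.trans ?_, fun h x hx => ?_⟩) rfl rfl
          · exact Finset.Ico_subset_Ico (by dsimp only; omega) (by dsimp only; omega)
          · have h2 := Finset.mem_Ico.1 (h hx)
            have h3 := (Finset.mem_sdiff.1 (hB hx)).2
            rw [Finset.mem_Ico] at h3
            dsimp only at h2
            exact Finset.mem_Ico.2 (by dsimp only; omega)
        · exact fun x hx => (hF x hx).trans (by dsimp only; omega)
        · refine Finset.union_subset_union_right (Finset.Ico_subset_Ico ?_ ?_) <;>
            dsimp only <;> omega
        · intro x
          rw [Finset.mem_sdiff, hS, hsplit, hsplit]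
          have hx := fun r hr hJ => hother r hr x hJ
          have hFx := hF x
          simp only [support, interval, Finset.mem_union, Finset.mem_Ico] at hx ⊢
          constructor
          · rintro ⟨(h | h) | h, h'⟩
            · exact Or.inl (Or.inl h)
            · exact Or.inl (Or.inr (by omega))
            · exact Or.inr h
          · rintro ((h | h) | ⟨r, hr, h⟩)
            · have := hFx h
              exact ⟨Or.inl (Or.inl h), by omega⟩
            · exact ⟨Or.inl (Or.inr (by omega)), by omega⟩
            · exact ⟨Or.inr ⟨r, hr, h⟩, fun h' => hx r hr (by omega) h⟩
    · intro x hx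
      rcases Finset.mem_insert.1 hx with rfl | hx
      · exact Nat.lt_succ_self _
      · exact (hF x hx).trans (Nat.lt_succ_self _)
    · intro x
      simp only [support, interval, Finset.mem_union, Finset.mem_insert, Finset.mem_Ico]
      rintro ((h | h) | h)
      · exact Or.inr (by omega)
      · exact Or.inl h
      · exact Or.inr (by omega)
    · intro x
      rw [hS, hsplit, hsplit]
      refine or_congr_left ?_
      simp only [support, interval, Finset.mem_union, Finset.mem_insert, Finset.mem_Ico]
      have hFx := hF x
      constructor
      · rintro (h | h)
        · exact Or.inl (Or.inr h)
        · by_cases hb : x = b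
          · exact Or.inl (Or.inl hb)
          · exact Or.inr (by omega)
      · rintro ((h | h) | h)
        · exact Or.inr (by omega)
        · exact Or.inl h
        · exact Or.inr (by omega)

end Segment

/-! ### Connected components of a non-crossing partition over a monotone map -/

/-- The preimage of `U` under `f` is a union of classes of `π`. -/
def Saturated (f : ℕ → ℕ) (π : Finset (Finset ℕ)) (U : Finset ℕ) : Prop :=
  ∀ B ∈ π, ∀ x ∈ B, ∀ y ∈ B, f x ∈ U → f y ∈ U

/-- The classes of `π` connect all the fibres of `f` over `T`. -/
def ConnectedOver (f : ℕ → ℕ) (T : Finset ℕ) (π : Finset (Finset ℕ)) : Prop :=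
  ∀ U ⊆ T, U.Nonempty → Saturated f π U → U = T

/-- The classes of `π` lying over `T`. -/
def restrictOver (f : ℕ → ℕ) (T : Finset ℕ) (π : Finset (Finset ℕ)) : Finset (Finset ℕ) :=
  π.filter fun B => ∀ x ∈ B, f x ∈ T

/-- The classes of `τ` are the connected components of `π`. -/
structure IsComponents (f : ℕ → ℕ) (τ π : Finset (Finset ℕ)) : Prop where
  exists_over : ∀ B ∈ π, ∃ T ∈ τ, ∀ x ∈ B, f x ∈ T
  connected : ∀ T ∈ τ, ConnectedOver f T (restrictOver f T π)

/-- The sum over the connected non-crossing partitions lying over `T`. -/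
def connSum (f : ℕ → ℕ) (w : Finset ℕ → ℝ) (S T : Finset ℕ) : ℝ :=
  ∑ π ∈ ncPart (S.filter fun x => f x ∈ T) with ConnectedOver f T π, ∏ B ∈ π, w B

theorem mem_restrictOver {f : ℕ → ℕ} {T B : Finset ℕ} {π : Finset (Finset ℕ)} :
    B ∈ restrictOver f T π ↔ B ∈ π ∧ ∀ x ∈ B, f x ∈ T := Finset.mem_filter

/-- The component of `i` is the intersection of all saturated subsets of `K` containing `i`. -/
theorem exists_isComponents {f : ℕ → ℕ} {S K : Finset ℕ} {π : Finset (Finset ℕ)}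
    (hf : ∀ x ∈ S, f x ∈ K) (hπ : IsSetPartition S π) :
    ∃ τ, IsSetPartition K τ ∧ IsComponents f τ π := by
  have hcl : ∀ i, ∃ C : Finset ℕ, ∀ j, j ∈ C ↔
      j ∈ K ∧ ∀ U ⊆ K, Saturated f π U → i ∈ U → j ∈ U := fun i =>
    ⟨K.filter fun j => ∀ U ⊆ K, Saturated f π U → i ∈ U → j ∈ U, fun j => Finset.mem_filter⟩
  choose comp hcomp using hcl
  have hBK : ∀ B ∈ π, ∀ x ∈ B, f x ∈ K := fun B hB x hx => hf x (hπ.subset B hB hx)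
  have hsub : ∀ i, comp i ⊆ K := fun i j hj => ((hcomp i j).1 hj).1
  have hself : ∀ i ∈ K, i ∈ comp i := fun i hi => (hcomp i i).2 ⟨hi, fun _ _ _ h => h⟩
  have hsat : ∀ i, Saturated f π (comp i) := fun i B hB x hx y hy h =>
    (hcomp i _).2 ⟨hBK B hB y hy, fun U hU hs hi =>
      hs B hB x hx y hy (((hcomp i _).1 h).2 U hU hs hi)⟩
  have htrans : ∀ i j, j ∈ comp i → comp j ⊆ comp i := fun i j hj l hl =>
    (hcomp i l).2 ⟨hsub j hl, fun U hU hs hi =>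
      ((hcomp j l).1 hl).2 U hU hs (((hcomp i j).1 hj).2 U hU hs hi)⟩
  have hsymm : ∀ i ∈ K, ∀ j, j ∈ comp i → i ∈ comp j := by
    -- Symmetry holds because the complement in `K` of a saturated set is saturated: a saturated set
    -- containing `j` but not `i` would separate `i` from its own component.
    refine fun i hiK j hj => (hcomp j i).2 ⟨hiK, fun U hU hs hjU => ?_⟩
    by_contra hi
    refine (Finset.mem_sdiff.1 (((hcomp i j).1 hj).2 (K \ U) Finset.sdiff_subset ?_
      (Finset.mem_sdiff.2 ⟨hiK, hi⟩))).2 hjU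
    exact fun B hB x hx y hy h => Finset.mem_sdiff.2 ⟨hBK B hB y hy, fun hyU =>
      (Finset.mem_sdiff.1 h).2 (hs B hB y hy x hx hyU)⟩
  have heq : ∀ i ∈ K, ∀ j, j ∈ comp i → comp j = comp i := fun i hi j hj =>
    (htrans i j hj).antisymm (htrans j i (hsymm i hi j hj))
  refine ⟨K.image comp, ⟨?_, ?_, ?_, ?_⟩, ⟨?_, ?_⟩⟩
  · intro T hT
    obtain ⟨i, hi, rfl⟩ := Finset.mem_image.1 hT
    exact ⟨i, hself i hi⟩
  · intro T hT
    obtain ⟨i, hi, rfl⟩ := Finset.mem_image.1 hT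
    exact hsub i
  · exact fun i hi => ⟨comp i, Finset.mem_image_of_mem _ hi, hself i hi⟩
  · intro T hT T' hT' l hl hl'
    obtain ⟨i, hi, rfl⟩ := Finset.mem_image.1 hT
    obtain ⟨j, hj, rfl⟩ := Finset.mem_image.1 hT'
    exact (heq i hi l hl).symm.trans (heq j hj l hl')
  · intro B hB
    obtain ⟨x, hx⟩ := hπ.nonempty B hB
    exact ⟨comp (f x), Finset.mem_image_of_mem _ (hBK B hB x hx), fun y hy =>
      hsat _ B hB x hx y hy (hself _ (hBK B hB x hx))⟩
  -- A subset of a component saturated for the restricted partition is saturated for `π`: a class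
  -- meeting it lies over the whole component.
  · intro T hT U hU hne hs
    obtain ⟨i, hi, rfl⟩ := Finset.mem_image.1 hT
    obtain ⟨j, hj⟩ := hne
    refine hU.antisymm fun l hl => ?_
    rw [← heq i hi j (hU hj)] at hl
    refine ((hcomp j l).1 hl).2 U (hU.trans (hsub i)) (fun B hB x hx y hy h => ?_) hj
    exact hs B (mem_restrictOver.2 ⟨hB, fun z hz => hsat i B hB x hx z hz (hU h)⟩) x hx y hy h

theorem IsComponents.saturated {f : ℕ → ℕ} {K T : Finset ℕ} {τ π : Finset (Finset ℕ)}
    (h : IsComponents f τ π) (hτ : IsSetPartition K τ) (hT : T ∈ τ) : Saturated f π T := by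
  intro B hB x hx y hy hxT
  obtain ⟨T', hT', hBT'⟩ := h.exists_over B hB
  rw [hτ.eq_of_mem T hT T' hT' _ hxT (hBT' x hx)]
  exact hBT' y hy

/-- `T ∩ T'` is nonempty and saturated for the classes over `T`, so connectedness forces it to be
all of `T`. -/
theorem IsComponents.subset {f : ℕ → ℕ} {K : Finset ℕ} {τ τ' π : Finset (Finset ℕ)}
    (h : IsComponents f τ π) (h' : IsComponents f τ' π)
    (hτ' : IsSetPartition K τ') {T T' : Finset ℕ} (hT : T ∈ τ) (hT' : T' ∈ τ') {i : ℕ}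
    (hi : i ∈ T) (hi' : i ∈ T') : T ⊆ T' := by
  rw [← Finset.inter_eq_left]
  refine h.connected T hT _ Finset.inter_subset_left ⟨i, Finset.mem_inter.2 ⟨hi, hi'⟩⟩ ?_
  intro B hB x hx y hy hxT
  obtain ⟨hBπ, hBT⟩ := mem_restrictOver.1 hB
  exact Finset.mem_inter.2 ⟨hBT y hy,
    h'.saturated hτ' hT' B hBπ x hx y hy (Finset.mem_inter.1 hxT).2⟩

theorem IsComponents.unique {f : ℕ → ℕ} {K : Finset ℕ} {τ τ' π : Finset (Finset ℕ)}
    (hτ : IsSetPartition K τ) (hτ' : IsSetPartition K τ')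
    (h : IsComponents f τ π) (h' : IsComponents f τ' π) : τ = τ' := by
  have key : ∀ {σ σ' : Finset (Finset ℕ)}, IsSetPartition K σ → IsSetPartition K σ' →
      IsComponents f σ π → IsComponents f σ' π → σ ⊆ σ' := by
    intro σ σ' hσ hσ' h h' T hT
    obtain ⟨i, hi⟩ := hσ.nonempty T hT
    obtain ⟨T', hT', hi'⟩ := hσ'.cover i (hσ.subset T hT hi)
    rwa [(h.subset h' hσ' hT hT' hi hi').antisymm (h'.subset h hσ hT' hT hi' hi)]
  exact (key hτ hτ' h h').antisymm (key hτ' hτ h' h)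

/-- If no class crossed the boundary of `p`, the part of `T` where `p` holds would be saturated,
nonempty and proper. -/
theorem ConnectedOver.exists_step {f : ℕ → ℕ} {T : Finset ℕ} {π : Finset (Finset ℕ)}
    (h : ConnectedOver f T (restrictOver f T π)) (p : ℕ → Prop) {i j : ℕ} (hi : i ∈ T) (hpi : p i)
    (hj : j ∈ T) (hpj : ¬ p j) :
    ∃ B ∈ π, (∀ x ∈ B, f x ∈ T) ∧ ∃ x ∈ B, ∃ y ∈ B, p (f x) ∧ ¬ p (f y) := by
  by_contra hcon
  push Not at hcon
  have hU := h (T.filter p) (Finset.filter_subset _ _) ⟨i, Finset.mem_filter.2 ⟨hi, hpi⟩⟩ ?_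
  · rw [← hU] at hj
    exact hpj (Finset.mem_filter.1 hj).2
  · intro B hB x hx y hy hxU
    obtain ⟨hBπ, hBT⟩ := mem_restrictOver.1 hB
    exact Finset.mem_filter.2 ⟨hBT y hy, hcon B hBπ hBT x hx y hy (Finset.mem_filter.1 hxU).2⟩

theorem IsComponents.nonCrossing {f : ℕ → ℕ} {S K : Finset ℕ} {τ π : Finset (Finset ℕ)}
    (hmono : ∀ x ∈ S, ∀ y ∈ S, f x < f y → x < y) (hπ : π ∈ ncPart S) (hτ : IsSetPartition K τ)
    (h : IsComponents f τ π) : NonCrossing τ := by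
  obtain ⟨hp, hnc⟩ := mem_ncPart.1 hπ
  intro T hT T' hT' i hi j hj k hk l hl hij hjk hkl
  by_contra hne
  have hd : ∀ {a b : ℕ}, a ∈ T → b ∈ T' → a ≠ b := by
    rintro a _ ha hb rfl
    exact hne (hτ.eq_of_mem T hT T' hT' a ha hb)
  -- `T'` has indices inside and outside the open interval from `i` to `k`, so one of its classes
  -- `B` leaves that interval, beyond `k` or below `i`.
  obtain ⟨B, hB, hBT, x, hx, y, hy, hpx, hpy⟩ := (h.connected T' hT').exists_step
    (fun a => i < a ∧ a < k) hj ⟨hij, hjk⟩ hl (fun h => absurd h.2 (not_lt_of_gt hkl))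
  have hBC : ∀ C : Finset ℕ, (∀ z ∈ C, f z ∈ T) → B ≠ C := by
    rintro _ hC rfl
    exact hd (hC x hx) (hBT x hx) rfl
  have hyi := hd hi (hBT y hy)
  have hyk := hd hk (hBT y hy)
  have hBS := hp.subset B hB
  rcases Nat.lt_or_ge k (f y) with hky | hky
  -- Now `k` lies strictly between `f x` and `f y` and `i` does not, so a class `C` over `T` steps
  -- out of that interval and crosses `B`.
  · obtain ⟨C, hC, hCT, z, hz, t, ht, hpz, hpt⟩ := (h.connected T hT).exists_step
      (fun a => f x < a ∧ a < f y) hk ⟨hpx.2, hky⟩ hi (fun h => absurd h.1 (not_lt_of_gt hpx.1))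
    have hCS := hp.subset C hC
    have h1 := hmono x (hBS hx) z (hCS hz) hpz.1
    have h2 := hmono z (hCS hz) y (hBS hy) hpz.2
    have htx := hd (hCT t ht) (hBT x hx)
    have hty := hd (hCT t ht) (hBT y hy)
    rcases Nat.lt_or_ge (f t) (f x) with h3 | h3
    · exact hBC C hCT (hnc C hC B hB t ht x hx z hz y hy (hmono t (hCS ht) x (hBS hx) h3) h1 h2).symm
    · exact hBC C hCT (hnc B hB C hC x hx z hz y hy t ht h1 h2
        (hmono y (hBS hy) t (hCS ht) (by omega)))
  -- The mirror case: `f y < i < f x`, and `C` leaves the interval containing `i`.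
  · obtain ⟨C, hC, hCT, z, hz, t, ht, hpz, hpt⟩ := (h.connected T hT).exists_step
      (fun a => f y < a ∧ a < f x) hi ⟨by omega, hpx.1⟩ hk
      (fun h => absurd h.2 (not_lt_of_gt hpx.2))
    have hCS := hp.subset C hC
    have h1 := hmono y (hBS hy) z (hCS hz) hpz.1
    have h2 := hmono z (hCS hz) x (hBS hx) hpz.2
    have htx := hd (hCT t ht) (hBT x hx)
    have hty := hd (hCT t ht) (hBT y hy)
    rcases Nat.lt_or_ge (f t) (f y) with h3 | h3
    · exact hBC C hCT (hnc C hC B hB t ht y hy z hz x hx (hmono t (hCS ht) y (hBS hy) h3) h1 h2).symm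
    · exact hBC C hCT (hnc B hB C hC y hy z hz x hx t ht h1 h2
        (hmono x (hBS hx) t (hCS ht) (by omega)))

theorem restrictOver_mem_ncPart {f : ℕ → ℕ} {S T : Finset ℕ} {π : Finset (Finset ℕ)}
    (hπ : π ∈ ncPart S) (hT : Saturated f π T) :
    restrictOver f T π ∈ ncPart (S.filter fun x => f x ∈ T) := by
  obtain ⟨hp, hnc⟩ := mem_ncPart.1 hπ
  have hs : ∀ B ∈ restrictOver f T π, B ∈ π := fun B hB => (mem_restrictOver.1 hB).1
  refine mem_ncPart.2 ⟨⟨fun B hB => hp.nonempty B (hs B hB), fun B hB x hx => ?_, fun x hx => ?_,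
    fun B hB C hC => hp.eq_of_mem B (hs B hB) C (hs C hC)⟩,
    fun B hB C hC => hnc B (hs B hB) C (hs C hC)⟩
  · exact Finset.mem_filter.2 ⟨hp.subset B (hs B hB) hx, (mem_restrictOver.1 hB).2 x hx⟩
  · obtain ⟨hxS, hxT⟩ := Finset.mem_filter.1 hx
    obtain ⟨B, hB, hxB⟩ := hp.cover x hxS
    exact ⟨B, mem_restrictOver.2 ⟨hB, fun y hy => hT B hB x hxB y hy hxT⟩, hxB⟩

/-! ### Assembling a partition from connected pieces -/

section Glue

variable {f : ℕ → ℕ} {S K : Finset ℕ} {τ : Finset (Finset ℕ)}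
  {p : ∀ T ∈ τ, Finset (Finset ℕ)}

/-- The union of partitions lying over the classes of `τ`. -/
def glue (τ : Finset (Finset ℕ)) (p : ∀ T ∈ τ, Finset (Finset ℕ)) : Finset (Finset ℕ) :=
  τ.attach.biUnion fun T => p T.1 T.2

theorem mem_glue {B : Finset ℕ} : B ∈ glue τ p ↔ ∃ T, ∃ hT : T ∈ τ, B ∈ p T hT := by
  simp [glue]

theorem restrictOver_glue (hτ : IsSetPartition K τ)
    (hp : ∀ T hT, IsSetPartition (S.filter fun x => f x ∈ T) (p T hT)) (T : Finset ℕ) (hT : T ∈ τ) :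
    restrictOver f T (glue τ p) = p T hT := by
  ext B
  rw [mem_restrictOver, mem_glue]
  constructor
  · rintro ⟨⟨T', hT', hB⟩, hBT⟩
    obtain ⟨x, hx⟩ := (hp T' hT').nonempty B hB
    obtain rfl := hτ.eq_of_mem T hT T' hT' (f x) (hBT x hx)
      (Finset.mem_filter.1 ((hp T' hT').subset B hB hx)).2
    exact hB
  · exact fun hB => ⟨⟨T, hT, hB⟩, fun x hx =>
      (Finset.mem_filter.1 ((hp T hT).subset B hB hx)).2⟩

/-- A crossing of classes over different `T` and `T'` projects under `f` to a crossing of `T` and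
`T'`: `f` is weakly increasing on `S`, and disjointness makes the inequalities strict. -/
theorem glue_mem_ncPart (hf : ∀ x ∈ S, f x ∈ K) (hmono : ∀ x ∈ S, ∀ y ∈ S, f x < f y → x < y)
    (hτ : τ ∈ ncPart K) (hp : ∀ T hT, p T hT ∈ ncPart (S.filter fun x => f x ∈ T)) :
    glue τ p ∈ ncPart S := by
  obtain ⟨hτ, hτnc⟩ := mem_ncPart.1 hτ
  have hpp := fun T hT => (mem_ncPart.1 (hp T hT)).1
  have hle : ∀ x ∈ S, ∀ y ∈ S, x < y → f x ≤ f y := fun x hx y hy hxy =>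
    not_lt.1 fun h => absurd (hmono y hy x hx h) (not_lt_of_gt hxy)
  have hm : ∀ {T hT B x}, B ∈ p T hT → x ∈ B → x ∈ S ∧ f x ∈ T := fun hB hx =>
    Finset.mem_filter.1 ((hpp _ _).subset _ hB hx)
  refine mem_ncPart.2 ⟨⟨?_, ?_, ?_, ?_⟩, ?_⟩
  · intro B hB
    obtain ⟨T, hT, hB⟩ := mem_glue.1 hB
    exact (hpp T hT).nonempty B hB
  · intro B hB x hx
    obtain ⟨T, hT, hB⟩ := mem_glue.1 hB
    exact (hm hB hx).1
  · intro x hx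
    obtain ⟨T, hT, hxT⟩ := hτ.cover (f x) (hf x hx)
    obtain ⟨B, hB, hxB⟩ := (hpp T hT).cover x (Finset.mem_filter.2 ⟨hx, hxT⟩)
    exact ⟨B, mem_glue.2 ⟨T, hT, hB⟩, hxB⟩
  · intro B hB B' hB' x hx hx'
    obtain ⟨T, hT, hB⟩ := mem_glue.1 hB
    obtain ⟨T', hT', hB'⟩ := mem_glue.1 hB'
    obtain rfl := hτ.eq_of_mem T hT T' hT' _ (hm hB hx).2 (hm hB' hx').2
    exact (hpp T hT).eq_of_mem B hB B' hB' x hx hx'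
  · intro B hB B' hB' i hi j hj k hk l hl hij hjk hkl
    obtain ⟨T, hT, hB⟩ := mem_glue.1 hB
    obtain ⟨T', hT', hB'⟩ := mem_glue.1 hB'
    obtain ⟨hiS, hiT⟩ := hm hB hi
    obtain ⟨hjS, hjT⟩ := hm hB' hj
    obtain ⟨hkS, hkT⟩ := hm hB hk
    obtain ⟨hlS, hlT⟩ := hm hB' hl
    by_cases hTT : T = T'
    · subst hTT
      exact (mem_ncPart.1 (hp T hT)).2 B hB B' hB' i hi j hj k hk l hl hij hjk hkl
    · have hd : ∀ {a b : ℕ}, a ∈ T → b ∈ T' → a ≠ b := by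
        rintro a _ ha hb rfl
        exact hTT (hτ.eq_of_mem T hT T' hT' a ha hb)
      exact absurd (hτnc T hT T' hT' _ hiT _ hjT _ hkT _ hlT
        ((hle i hiS j hjS hij).lt_of_ne (hd hiT hjT))
        ((hle j hjS k hkS hjk).lt_of_ne (hd hkT hjT).symm)
        ((hle k hkS l hlS hkl).lt_of_ne (hd hkT hlT))) hTT

theorem isComponents_glue (hτ : IsSetPartition K τ)
    (hp : ∀ T hT, IsSetPartition (S.filter fun x => f x ∈ T) (p T hT))
    (hc : ∀ T hT, ConnectedOver f T (p T hT)) : IsComponents f τ (glue τ p) where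
  exists_over B hB := by
    obtain ⟨T, hT, hB⟩ := mem_glue.1 hB
    exact ⟨T, hT, fun x hx => (Finset.mem_filter.1 ((hp T hT).subset B hB hx)).2⟩
  connected T hT := by
    rw [restrictOver_glue hτ hp T hT]
    exact hc T hT

theorem IsComponents.glue_restrictOver {π : Finset (Finset ℕ)} (h : IsComponents f τ π) :
    glue τ (fun T _ => restrictOver f T π) = π := by
  ext B
  rw [mem_glue]
  constructor
  · rintro ⟨T, hT, hB⟩
    exact (mem_restrictOver.1 hB).1
  · intro hB
    obtain ⟨T, hT, hBT⟩ := h.exists_over B hB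
    exact ⟨T, hT, mem_restrictOver.2 ⟨hB, hBT⟩⟩

theorem prod_glue (hτ : IsSetPartition K τ)
    (hp : ∀ T hT, IsSetPartition (S.filter fun x => f x ∈ T) (p T hT)) (w : Finset ℕ → ℝ) :
    ∏ B ∈ glue τ p, w B = ∏ T ∈ τ.attach, ∏ B ∈ p T.1 T.2, w B := by
  refine Finset.prod_biUnion fun T _ T' _ hne => Finset.disjoint_left.2 fun B hB hB' => hne ?_
  obtain ⟨x, hx⟩ := (hp T.1 T.2).nonempty B hB
  exact Subtype.ext (hτ.eq_of_mem _ T.2 _ T'.2 (f x)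
    (Finset.mem_filter.1 ((hp _ _).subset B hB hx)).2
    (Finset.mem_filter.1 ((hp _ _).subset B hB' hx)).2)

end Glue

/-- A sum over non-crossing partitions, arranged according to the connected components. -/
theorem ncSum_eq_ncSum_connSum {f : ℕ → ℕ} {S K : Finset ℕ} (hf : ∀ x ∈ S, f x ∈ K)
    (hmono : ∀ x ∈ S, ∀ y ∈ S, f x < f y → x < y) (w : Finset ℕ → ℝ) :
    ncSum w S = ncSum (connSum f w S) K := by
  -- Each `π` has exactly one partition into components, and it is non-crossing; the sum of
  -- indicators lets the order of summation be exchanged.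
  have h1 : ∀ π ∈ ncPart S, ∏ B ∈ π, w B =
      ∑ τ ∈ ncPart K, if IsComponents f τ π then ∏ B ∈ π, w B else 0 := by
    intro π hπ
    obtain ⟨τ, hτ, hc⟩ := exists_isComponents hf (mem_ncPart.1 hπ).1
    rw [Finset.sum_eq_single_of_mem τ (mem_ncPart.2 ⟨hτ, hc.nonCrossing hmono hπ hτ⟩),
      if_pos hc]
    exact fun τ' hτ' hne => if_neg fun hc' =>
      hne (IsComponents.unique (mem_ncPart.1 hτ').1 hτ hc' hc)
  rw [ncSum, Finset.sum_congr rfl h1, Finset.sum_comm, ncSum]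
  refine Finset.sum_congr rfl fun τ hτ => ?_
  have hτp := (mem_ncPart.1 hτ).1
  simp only [connSum]
  -- The product over `τ` of connected sums becomes a sum over choices of one connected partition
  -- per class; restriction and gluing are inverse to each other.
  rw [Finset.prod_sum, ← Finset.sum_filter]
  have hpi : ∀ p ∈ τ.pi (fun T => (ncPart (S.filter fun x => f x ∈ T)).filter (ConnectedOver f T)),
      ∀ T hT, p T hT ∈ ncPart (S.filter fun x => f x ∈ T) ∧ ConnectedOver f T (p T hT) :=
    fun p hp T hT => Finset.mem_filter.1 (Finset.mem_pi.1 hp T hT)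
  have hpi' := fun p hp T hT => (mem_ncPart.1 (hpi p hp T hT).1).1
  refine Finset.sum_bij' (fun π _ T _ => restrictOver f T π) (fun p _ => glue τ p) ?_ ?_ ?_ ?_ ?_
  · intro π hπ
    obtain ⟨hπ, hc⟩ := Finset.mem_filter.1 hπ
    exact Finset.mem_pi.2 fun T hT => Finset.mem_filter.2
      ⟨restrictOver_mem_ncPart hπ (hc.saturated hτp hT), hc.connected T hT⟩
  · intro p hp
    exact Finset.mem_filter.2 ⟨glue_mem_ncPart hf hmono hτ fun T hT => (hpi p hp T hT).1,
      isComponents_glue hτp (hpi' p hp) fun T hT => (hpi p hp T hT).2⟩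
  · intro π hπ
    exact (Finset.mem_filter.1 hπ).2.glue_restrictOver
  · intro p hp
    funext T hT
    exact restrictOver_glue hτp (hpi' p hp) T hT
  · intro π hπ
    obtain ⟨hπ, hc⟩ := Finset.mem_filter.1 hπ
    conv_lhs => rw [← hc.glue_restrictOver]
    exact prod_glue hτp (fun T hT =>
      (mem_ncPart.1 (restrictOver_mem_ncPart hπ (hc.saturated hτp hT))).1) w

/-- If the moments of the products over the fibres of `f` are sums over non-crossing partitions,
then the free cumulants are the sums over connected non-crossing partitions. -/
theorem connSum_eq_cumulantOn {A : Type*} [Ring A] [Algebra ℝ A] (φ : A →ₗ[ℝ] ℝ) (hφ : φ 1 = 1)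
    {f : ℕ → ℕ} {S K : Finset ℕ} (hmono : ∀ x ∈ S, ∀ y ∈ S, f x < f y → x < y)
    (w : Finset ℕ → ℝ) (V : ℕ → A)
    (h : ∀ T ⊆ K, φ (prodOn V T) = ncSum w (S.filter fun x => f x ∈ T)) :
    connSum f w S K = cumulantOn φ V K := by
  rcases K.eq_empty_or_nonempty with rfl | hK
  · rw [cumulantOn_empty φ hφ, connSum]
    simp only [Finset.notMem_empty, Finset.filter_false]
    rw [ncPart_empty, Finset.filter_true_of_mem, Finset.sum_singleton, Finset.prod_empty]
    intro π _ U hU _ _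
    exact Finset.subset_empty.1 hU
  · refine eq_cumulantOn φ hφ V (connSum f w S) K (fun T hT => ?_) K le_rfl hK
    rw [h T hT, ncSum_eq_ncSum_connSum (f := f) (K := T) (fun x hx => (Finset.mem_filter.1 hx).2)
      (fun x hx y hy => hmono x (Finset.mem_filter.1 hx).1 y (Finset.mem_filter.1 hy).1)]
    -- Connected sums over `T' ⊆ T` see only the positions over `T'`, so restricting `S` to the
    -- positions over `T` changes nothing.
    refine ncSum_congr fun T' hT' _ => ?_
    rw [connSum, connSum]
    congr 2
    rw [Finset.filter_filter]
    exact congrArg _ (Finset.filter_congr fun x _ => ⟨fun h => h.2, fun h => ⟨hT' h, h⟩⟩)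

/-! ### The interval partition -/

section Offset

variable {k : ℕ} (s : Fin k → ℕ)

/-- The starting position of the block with index `i`. -/
def offset (i : ℕ) : ℕ := ∑ a ∈ Finset.range i, ext0 s a

/-- The index of the block containing the position `x`. -/
def blockIndex (x : ℕ) : ℕ :=
  if h : x < ∑ i, s i then (finSigmaFinEquiv.symm (⟨x, h⟩ : Fin (∑ i, s i))).1 else k

/-- The positions in the block with index `i`. -/
def block (i : ℕ) : Finset ℕ := Finset.Ico (offset s i) (offset s (i + 1))

theorem offset_succ (i : Fin k) : offset s (i + 1) = offset s i + s i := by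
  rw [offset, Finset.sum_range_succ, ext0_of_lt s i.2, offset]

theorem offset_mono : Monotone (offset s) := fun _ _ h =>
  Finset.sum_le_sum_of_subset (Finset.range_mono h)

theorem offset_last : offset s k = ∑ i, s i := by
  rw [offset, Finset.sum_range]
  exact Finset.sum_congr rfl fun i _ => ext0_of_lt s i.2

theorem finSigmaFinEquiv_val (i : Fin k) (j : Fin (s i)) :
    (finSigmaFinEquiv ⟨i, j⟩ : ℕ) = offset s i + j := by
  rw [finSigmaFinEquiv_apply, offset, Finset.sum_range]
  congr 1
  exact Finset.sum_congr rfl fun a _ => (ext0_of_lt s (a.2.trans i.2)).symm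

variable {s}

theorem blockIndex_fin (x : Fin (∑ i, s i)) :
    blockIndex s x = (finSigmaFinEquiv.symm x).1 := dif_pos x.2

theorem blockIndex_lt {x : ℕ} (hx : x < ∑ i, s i) : blockIndex s x < k := by
  rw [blockIndex, dif_pos hx]
  exact Fin.is_lt _

theorem lt_sum_of_mem_block {x i : ℕ} (hi : i < k) (hx : x ∈ block s i) : x < ∑ i, s i := by
  rw [← offset_last]
  exact (Finset.mem_Ico.1 hx).2.trans_le (offset_mono s hi)

/-- Reconciles the two descriptions of a block: by partial sums of the lengths and by
`finSigmaFinEquiv`. -/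
theorem mem_block_iff {x i : ℕ} (hi : i < k) :
    x ∈ block s i ↔ x < ∑ i, s i ∧ blockIndex s x = i := by
  lift i to Fin k using hi
  constructor
  · intro h
    have hx := lt_sum_of_mem_block i.2 h
    rw [block, Finset.mem_Ico, offset_succ] at h
    refine ⟨hx, ?_⟩
    have h1 : (⟨x, hx⟩ : Fin (∑ i, s i)) =
        finSigmaFinEquiv ⟨i, (⟨x - offset s i, by omega⟩ : Fin (s i))⟩ := by
      apply Fin.ext
      rw [finSigmaFinEquiv_val]
      dsimp only
      omega
    rw [blockIndex, dif_pos hx, h1, Equiv.symm_apply_apply]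
  · rintro ⟨hx, h⟩
    rw [blockIndex, dif_pos hx] at h
    obtain ⟨⟨a, b⟩, hab⟩ := (finSigmaFinEquiv (m := k) (n := s)).surjective ⟨x, hx⟩
    rw [← hab, Equiv.symm_apply_apply] at h
    obtain rfl := Fin.ext h
    have h2 := congrArg Fin.val hab
    rw [finSigmaFinEquiv_val] at h2
    dsimp only at h2
    rw [block, Finset.mem_Ico, offset_succ]
    have := b.2
    dsimp only at this ⊢
    omega

theorem lt_of_blockIndex_lt {x y : ℕ} (hx : x < ∑ i, s i) (hy : y < ∑ i, s i)
    (h : blockIndex s x < blockIndex s y) : x < y := by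
  have h1 := (mem_block_iff (blockIndex_lt hx)).2 ⟨hx, rfl⟩
  have h2 := (mem_block_iff (blockIndex_lt hy)).2 ⟨hy, rfl⟩
  rw [block, Finset.mem_Ico] at h1 h2
  exact h1.2.trans_le ((offset_mono s h).trans h2.1)

theorem exists_blockIndex_eq (hs : ∀ i, 0 < s i) {i : ℕ} (hi : i < k) :
    ∃ x : Fin (∑ i, s i), blockIndex s x = i :=
  ⟨finSigmaFinEquiv ⟨⟨i, hi⟩, ⟨0, hs _⟩⟩, by rw [blockIndex_fin, Equiv.symm_apply_apply]⟩

end Offset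

/-! ### Classes, connectedness and homogeneity -/

theorem SameClass.symm {n : ℕ} {π : Part n} {x y : Fin n} (h : SameClass π x y) :
    SameClass π y x := by
  obtain ⟨B, hB, hx, hy⟩ := h
  exact ⟨B, hB, hy, hx⟩

theorem SameClass.trans {n : ℕ} {π : Part n} {x y z : Fin n} (h : SameClass π x y)
    (h' : SameClass π y z) : SameClass π x z := by
  obtain ⟨B, hB, hx, hy⟩ := h
  obtain ⟨C, hC, hy', hz⟩ := h'
  obtain rfl := π.eq_of_mem hB hC hy hy'
  exact ⟨B, hB, hx, hz⟩

theorem SameClass.refl {n : ℕ} (π : Part n) (x : Fin n) : SameClass π x x := by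
  obtain ⟨B, hB, hx⟩ := π.exists_mem (Finset.mem_univ x)
  exact ⟨B, hB, hx, hx⟩

theorem exists_subset_iff {n : ℕ} (τ : Part n) {B : Finset (Fin n)} (hB : B.Nonempty) :
    (∃ C ∈ τ.parts, B ⊆ C) ↔ ∀ x ∈ B, ∀ y ∈ B, SameClass τ x y := by
  constructor
  · rintro ⟨C, hC, hBC⟩ x hx y hy
    exact ⟨C, hC, hBC hx, hBC hy⟩
  · intro h
    obtain ⟨x, hx⟩ := hB
    obtain ⟨C, hC, hxC⟩ := τ.exists_mem (Finset.mem_univ x)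
    refine ⟨C, hC, fun y hy => ?_⟩
    obtain ⟨D, hD, hxD, hyD⟩ := h x hx y hy
    rwa [τ.eq_of_mem hC hD hxC hxD]

theorem le_iff_sameClass {n : ℕ} {π τ : Part n} :
    π ≤ τ ↔ ∀ x y, SameClass π x y → SameClass τ x y := by
  constructor
  · rintro h x y ⟨B, hB, hx, hy⟩
    obtain ⟨C, hC, hBC⟩ := h hB
    exact ⟨C, hC, hBC hx, hBC hy⟩
  · intro h B hB
    exact (exists_subset_iff τ (π.nonempty_of_mem_parts hB)).2 fun x hx y hy =>
      h x y ⟨B, hB, hx, hy⟩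

theorem sameClass_top {n : ℕ} (x y : Fin n) : SameClass ⊤ x y := by
  obtain ⟨B, hB, hx⟩ := (⊤ : Part n).exists_mem (Finset.mem_univ x)
  obtain rfl := Finset.mem_singleton.1 (Finpartition.parts_top_subset _ hB)
  exact ⟨_, hB, hx, Finset.mem_univ y⟩

theorem sameClass_ofSetoid {n : ℕ} (r : Setoid (Fin n)) (x y : Fin n) :
    SameClass (Finpartition.ofSetoid r) x y ↔ r x y := by
  rw [← Finpartition.mem_part_ofSetoid_iff_rel]
  constructor
  · rintro ⟨B, hB, hx, hy⟩
    rwa [Finpartition.part_eq_of_mem _ hB hx]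
  · intro h
    exact ⟨_, Finpartition.part_mem _ |>.2 (Finset.mem_univ x),
      Finpartition.mem_part _ (Finset.mem_univ x), h⟩

theorem sameClass_intervalPartition {k : ℕ} {s : Fin k → ℕ} (x y : Fin (∑ i, s i)) :
    SameClass (intervalPartition s) x y ↔ blockIndex s x = blockIndex s y := by
  rw [intervalPartition, blockIndex_fin, blockIndex_fin, ← Fin.ext_iff]
  convert sameClass_ofSetoid _ x y using 2
  exact Iff.rfl

theorem isHomogeneousClass_iff {k : ℕ} {s : Fin k → ℕ} {B : Finset (Fin (∑ i, s i))}
    (hB : B.Nonempty) : IsHomogeneousClass (intervalPartition s) B ↔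
      ∃ i < k, B.map (Fin.valOrderEmb _).toEmbedding ⊆ block s i := by
  rw [IsHomogeneousClass, exists_subset_iff _ hB]
  simp only [sameClass_intervalPartition]
  constructor
  · intro h
    obtain ⟨x, hx⟩ := hB
    refine ⟨blockIndex s x, blockIndex_lt x.2, fun y hy => ?_⟩
    obtain ⟨z, hz, rfl⟩ := Finset.mem_map.1 hy
    exact (mem_block_iff (blockIndex_lt x.2)).2 ⟨z.2, h z hz x hx⟩
  · rintro ⟨i, hi, hBi⟩ x hx y hy
    have hm : ∀ z ∈ B, blockIndex s z = i := fun z hz =>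
      ((mem_block_iff hi).1 (hBi (Finset.mem_map_of_mem _ hz))).2
    rw [hm x hx, hm y hy]

theorem isNonHomogeneous_iff {k : ℕ} {s : Fin k → ℕ} (π : Part (∑ i, s i)) :
    IsNonHomogeneous (intervalPartition s) π ↔
      ∀ B ∈ mapParts (Fin.valOrderEmb _) π, ¬ ∃ i < k, B ⊆ block s i := by
  rw [mapParts, Finset.forall_mem_image, IsNonHomogeneous]
  exact forall₂_congr fun B hB =>
    not_congr (isHomogeneousClass_iff (π.nonempty_of_mem_parts hB))

/-- Saturated sets of block indices correspond to ways of cutting the positions without splitting a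
class of `π` or a block. Nonempty blocks are needed, since the index of an empty block would be a
saturated set invisible to the positions. -/
theorem isConnectedTo_iff {k : ℕ} {s : Fin k → ℕ} (hs : ∀ i, 0 < s i) (π : Part (∑ i, s i)) :
    IsConnectedTo (intervalPartition s) π ↔
      ConnectedOver (blockIndex s) (Finset.range k) (mapParts (Fin.valOrderEmb _) π) := by
  have hmem : ∀ {B : Finset (Fin (∑ i, s i))} {x : Fin (∑ i, s i)}, x ∈ B →
      (x : ℕ) ∈ B.map (Fin.valOrderEmb _).toEmbedding := fun hx => Finset.mem_map_of_mem _ hx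
  constructor
  · intro h U hU ⟨i, hi⟩ hsat
    obtain ⟨x, hx⟩ := exists_blockIndex_eq hs (Finset.mem_range.1 (hU hi))
    -- The partition according to whether the block index lies in `U` is above both `π` and `σ`,
    -- hence above their join `⊤`.
    have htop : ⊤ ≤ Finpartition.ofSetoid
      (Setoid.ker fun x : Fin (∑ i, s i) => blockIndex s x ∈ U) := (isLUB_le_iff h).2 (by
        intro ρ hρ
        rw [le_iff_sameClass]
        intro a b hab
        rw [sameClass_ofSetoid, Setoid.ker_def]
        rcases hρ with rfl | hρ
        · obtain ⟨B, hB, ha, hb⟩ := hab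
          have hB' : B.map (Fin.valOrderEmb _).toEmbedding ∈ mapParts (Fin.valOrderEmb _) ρ :=
            mem_mapParts.2 ⟨B, hB, rfl⟩
          exact propext ⟨hsat _ hB' _ (hmem ha) _ (hmem hb), hsat _ hB' _ (hmem hb) _ (hmem ha)⟩
        · rw [Set.mem_singleton_iff.1 hρ, sameClass_intervalPartition] at hab
          rw [hab])
    refine hU.antisymm fun j hj => ?_
    obtain ⟨y, hy⟩ := exists_blockIndex_eq hs (Finset.mem_range.1 hj)
    have hxy := le_iff_sameClass.1 htop x y (sameClass_top x y)
    rw [sameClass_ofSetoid, Setoid.ker_def, hx, hy] at hxy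
    exact hxy.mp hi
  · intro h
    refine ⟨fun ρ _ => le_top, fun τ hτ => ?_⟩
    have hπ := le_iff_sameClass.1 (hτ (Set.mem_insert _ _))
    have hσ := le_iff_sameClass.1 (hτ (Set.mem_insert_of_mem _ rfl))
    simp only [sameClass_intervalPartition] at hσ
    rw [le_iff_sameClass]
    intro x y _
    -- For an upper bound `τ`, the indices of the blocks met by the `τ`-class of `x` form a
    -- saturated set, so this class meets every block and, containing each block it meets, is
    -- everything.
    have hU := h ((Finset.range k).filter fun i => ∃ z, SameClass τ x z ∧ blockIndex s z = i)
      (Finset.filter_subset _ _) ⟨blockIndex s x, Finset.mem_filter.2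
        ⟨Finset.mem_range.2 (blockIndex_lt x.2), x, SameClass.refl τ x, rfl⟩⟩ (by
        intro B' hB' a' ha' b' hb' haU
        obtain ⟨B, hB, rfl⟩ := mem_mapParts.1 hB'
        obtain ⟨a, ha, rfl⟩ := Finset.mem_map.1 ha'
        obtain ⟨b, hb, rfl⟩ := Finset.mem_map.1 hb'
        obtain ⟨z, hxz, hz⟩ := (Finset.mem_filter.1 haU).2
        exact Finset.mem_filter.2 ⟨Finset.mem_range.2 (blockIndex_lt b.2), b,
          (hxz.trans (hσ z a hz)).trans (hπ a b ⟨B, hB, ha, hb⟩), rfl⟩)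
    have hy : blockIndex s y ∈ Finset.range k := Finset.mem_range.2 (blockIndex_lt y.2)
    rw [← hU] at hy
    obtain ⟨z, hxz, hz⟩ := (Finset.mem_filter.1 hy).2
    exact hxz.trans (hσ z y hz)

/-! ### Moments and cumulants of the entries indexed by blocks -/

variable {A : Type*} [Ring A] [Algebra ℝ A]

/-- Stated for a general family `g` so that plain products and Appell polynomials are instances, and
for all `T` because the identification of cumulants needs the moments of every subfamily. -/
theorem apply_prodOn_value (φ : A →ₗ[ℝ] ℝ) (hφ : φ 1 = 1) (Y : ℕ → A) {k : ℕ} (s : Fin k → ℕ)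
    (g : ℕ → Segment) (hg : ∀ i < k, (g i).support = block s i)
    (hplain : ∀ i < k, ∀ x ∈ (g i).plain, x < (g i).start) (T : Finset ℕ)
    (hT : T ⊆ Finset.range k) :
    φ (prodOn (fun i => (g i).value φ Y) T) =
      ncSum (fun B => if ∃ i < k, B ⊆ (g i).interval then 0 else cumulantOn φ Y B)
        ((Finset.range (∑ i, s i)).filter fun x => blockIndex s x ∈ T) := by
  have hTk : ∀ i ∈ T, i < k := fun i hi => Finset.mem_range.1 (hT hi)
  have hmap : T.sort.map (fun i => (g i).value φ Y) = (T.sort.map g).map (Segment.value φ Y) := by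
    rw [List.map_map]
    rfl
  rw [prodOn, hmap, Segment.apply_prod_value φ hφ Y _ ?_
    ((Finset.range (∑ i, s i)).filter fun x => blockIndex s x ∈ T)]
  · refine ncSum_congr fun B hB hne => ?_
    rw [Segment.weight]
    refine if_congr ⟨?_, ?_⟩ rfl rfl
    · rintro ⟨t, ht, hBt⟩
      obtain ⟨i, hi, rfl⟩ := List.mem_map.1 ht
      exact ⟨i, hTk i ((Finset.mem_sort _).1 hi), hBt⟩
    · rintro ⟨i, hi, hBi⟩
      refine ⟨g i, List.mem_map_of_mem ((Finset.mem_sort _).2 ?_), hBi⟩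
      -- A nonempty class over `T` inside the interval of `g i` forces `i ∈ T`, so the condition may
      -- range over all `i < k`, independently of `T`.
      obtain ⟨x, hx⟩ := hne
      have h1 : x ∈ (g i).support := Finset.mem_union_right _ (hBi hx)
      rw [hg i hi, mem_block_iff hi] at h1
      rw [← h1.2]
      exact (Finset.mem_filter.1 (hB hx)).2
  · intro x
    rw [Finset.mem_filter, Finset.mem_range]
    constructor
    · rintro ⟨hx, hxT⟩
      refine ⟨_, List.mem_map_of_mem ((Finset.mem_sort _).2 hxT), ?_⟩
      rw [hg _ (hTk _ hxT), mem_block_iff (hTk _ hxT)]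
      exact ⟨hx, rfl⟩
    · rintro ⟨t, ht, hxt⟩
      obtain ⟨i, hi, rfl⟩ := List.mem_map.1 ht
      rw [Finset.mem_sort] at hi
      rw [hg i (hTk i hi), mem_block_iff (hTk i hi)] at hxt
      exact ⟨hxt.1, by rw [hxt.2]; exact hi⟩
  · constructor
    · intro t ht
      obtain ⟨i, hi, rfl⟩ := List.mem_map.1 ht
      exact hplain i (hTk i ((Finset.mem_sort _).1 hi))
    · rw [List.pairwise_map]
      refine List.Pairwise.imp_of_mem ?_ T.sortedLT_sort.pairwise
      intro i j hi hj hij x hx y hy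
      rw [Finset.mem_sort] at hi hj
      rw [hg i (hTk i hi), block, Finset.mem_Ico] at hx
      rw [hg j (hTk j hj), block, Finset.mem_Ico] at hy
      exact hx.2.trans_le ((offset_mono s hij).trans hy.1)

theorem map_valOrderEmb_univ (n : ℕ) :
    Finset.univ.map (Fin.valOrderEmb n).toEmbedding = Finset.range n := by
  ext x
  simp only [Finset.mem_map, Finset.mem_univ, true_and, Finset.mem_range]
  exact ⟨fun ⟨y, hy⟩ => hy ▸ y.2, fun h => ⟨⟨x, h⟩, rfl⟩⟩

theorem filter_blockIndex_range {k : ℕ} (s : Fin k → ℕ) :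
    ((Finset.range (∑ i, s i)).filter fun x => blockIndex s x ∈ Finset.range k) =
      Finset.range (∑ i, s i) :=
  Finset.filter_true_of_mem fun _ hx =>
    Finset.mem_range.2 (blockIndex_lt (Finset.mem_range.1 hx))

theorem jointMoment_value (φ : A →ₗ[ℝ] ℝ) (hφ : φ 1 = 1) (Y : ℕ → A) {k : ℕ} (s : Fin k → ℕ)
    (g : ℕ → Segment) (hg : ∀ i < k, (g i).support = block s i)
    (hplain : ∀ i < k, ∀ x ∈ (g i).plain, x < (g i).start) :
    jointMoment φ (fun i : Fin k => (g i).value φ Y) =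
      ncSum (fun B => if ∃ i < k, B ⊆ (g i).interval then 0 else cumulantOn φ Y B)
        (Finset.range (∑ i, s i)) := by
  have h := apply_prodOn_value φ hφ Y s g hg hplain (Finset.range k) le_rfl
  rw [filter_blockIndex_range] at h
  rw [← h, ← map_valOrderEmb_univ, ← orderedProd_comp]
  rfl

theorem freeCumulant_value (φ : A →ₗ[ℝ] ℝ) (hφ : φ 1 = 1) (Y : ℕ → A) {k : ℕ} (s : Fin k → ℕ)
    (g : ℕ → Segment) (hg : ∀ i < k, (g i).support = block s i)
    (hplain : ∀ i < k, ∀ x ∈ (g i).plain, x < (g i).start) :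
    freeCumulant φ (fun i : Fin k => (g i).value φ Y) =
      ∑ π ∈ ncPart (Finset.range (∑ i, s i)) with
        ConnectedOver (blockIndex s) (Finset.range k) π,
        ∏ B ∈ π, if ∃ i < k, B ⊆ (g i).interval then 0 else cumulantOn φ Y B := by
  have h := connSum_eq_cumulantOn φ hφ (f := blockIndex s) (S := Finset.range (∑ i, s i))
    (K := Finset.range k)
    (fun x hx y hy => lt_of_blockIndex_lt (Finset.mem_range.1 hx) (Finset.mem_range.1 hy)) _ _
    (apply_prodOn_value φ hφ Y s g hg hplain)
  rw [connSum, filter_blockIndex_range] at h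
  rw [h, ← map_valOrderEmb_univ, ← freeCumulant_comp]
  rfl

/-- The defining conditions determine the family, so it is the explicit recursive one; this is the
only way the axioms of the Appell polynomials enter. -/
theorem freeAppell_eq_recV (φ : A →ₗ[ℝ] ℝ) (hφ : φ 1 = 1) {n : ℕ} (X : Fin n → A) :
    freeAppell φ X = recV φ (ext0 X) n 0 := by
  have h : freeAppellPoly φ X = recP φ n X :=
    congrFun (congrFun (isFreeAppellFamily_unique φ hφ (isFreeAppellFamily_freeAppellPoly φ hφ)
      (isFreeAppellFamily_recP φ hφ)) n) X
  rw [freeAppell, h, recP, evalAt_ext0]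
  exact (recV_eq_recW φ (ext0 X) n 0).symm

/-! ### The segments attached to the blocks of a concatenated tuple -/

section Concat

variable {k : ℕ} {s : Fin k → ℕ}

/-- The segment of the product of the variables in the block `i`. -/
def plainSegment (s : Fin k → ℕ) (i : ℕ) : Segment := ⟨block s i, offset s (i + 1), 0⟩

/-- The segment of the free Appell polynomial in the variables in the block `i`. -/
def appellSegment (s : Fin k → ℕ) (i : ℕ) : Segment := ⟨∅, offset s i, ext0 s i⟩

theorem plainSegment_interval (i : ℕ) : (plainSegment s i).interval = ∅ := by
  simp [Segment.interval, plainSegment]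

theorem appellSegment_interval (i : ℕ) : (appellSegment s i).interval = block s i := by
  rw [Segment.interval, appellSegment, block, offset, offset, Finset.sum_range_succ]

theorem plainSegment_support (i : ℕ) : (plainSegment s i).support = block s i := by
  rw [Segment.support, plainSegment_interval, Finset.union_empty, plainSegment]

theorem appellSegment_support (i : ℕ) : (appellSegment s i).support = block s i := by
  rw [Segment.support, appellSegment_interval, appellSegment, Finset.empty_union]

theorem ext0_concat {I B : Type*} [Zero B] (X : I → B) (u : ∀ i, Fin (s i) → I) (i : Fin k)
    (j : Fin (s i)) : ext0 (X ∘ concat u) (offset s i + j) = X (u i j) := by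
  have h : (fun q : (i : Fin k) × Fin (s i) => u q.1 q.2)
      (finSigmaFinEquiv.symm (finSigmaFinEquiv ⟨i, j⟩)) = u i j := by
    rw [Equiv.symm_apply_apply]
  rw [← finSigmaFinEquiv_val, ext0_of_lt _ (Fin.is_lt _)]
  exact congrArg X h

theorem plainSegment_value (φ : A →ₗ[ℝ] ℝ) {I : Type*} (X : I → A) (u : ∀ i, Fin (s i) → I)
    (i : Fin k) :
    (plainSegment s i).value φ (ext0 (X ∘ concat u)) = orderedProd (X ∘ u i) := by
  have h : orderedProd (fun j : Fin (s i) => ext0 (X ∘ concat u) (offset s i + j)) = _ :=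
    orderedProd_comp (ext0 (X ∘ concat u)) (OrderEmbedding.ofStrictMono
    (fun j : Fin (s i) => offset s i + (j : ℕ)) fun a b hab => Nat.add_lt_add_left hab _)
  simp only [ext0_concat] at h
  rw [Segment.value, plainSegment, recV, mul_one]
  refine Eq.trans ?_ h.symm
  congr 1
  ext x
  simp only [block, offset_succ, Finset.mem_Ico, Finset.mem_map, Finset.mem_univ, true_and]
  constructor
  · exact fun hx => ⟨⟨x - offset s i, by omega⟩, Nat.add_sub_cancel' hx.1⟩
  · rintro ⟨j, rfl⟩
    exact ⟨Nat.le_add_right _ _, Nat.add_lt_add_left j.2 _⟩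

theorem appellSegment_value (φ : A →ₗ[ℝ] ℝ) (hφ : φ 1 = 1) {I : Type*} (X : I → A)
    (u : ∀ i, Fin (s i) → I) (i : Fin k) :
    (appellSegment s i).value φ (ext0 (X ∘ concat u)) = freeAppell φ (X ∘ u i) := by
  rw [Segment.value, appellSegment, prodOn_empty, one_mul, ext0_of_lt s i.2,
    freeAppell_eq_recV φ hφ]
  refine recV_congr _ _ _ _ _ _ fun j hj => ?_
  rw [ext0_concat X u i ⟨j, hj⟩, zero_add, ext0_of_lt _ hj]
  rfl

theorem sum_partCumulant_filter (φ : A →ₗ[ℝ] ℝ) {n : ℕ} (Z : Fin n → A) (P : Part n → Prop)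
    (Q : Finset (Finset ℕ) → Prop) [DecidablePred P] [DecidablePred Q]
    (hPQ : ∀ π, P π ↔ Q (mapParts (Fin.valOrderEmb n) π)) :
    ∑ π ∈ NC n with P π, partCumulant φ π Z =
      ∑ π ∈ ncPart (Finset.range n) with Q π, ∏ B ∈ π, cumulantOn φ (ext0 Z) B := by
  rw [← map_valOrderEmb_univ, ← sum_NC_filter_eq _ P Q hPQ]
  refine Finset.sum_congr rfl fun π _ => ?_
  rw [← partCumulant_comp]
  congr 1
  funext j
  exact (ext0_of_lt Z j.2).symm

/-- A single forbidden class kills the product, so zero weights act as a condition on the partition.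
-/
theorem sum_prod_ite_zero (E : Finset (Finset (Finset ℕ))) (w : Finset ℕ → ℝ)
    (h : Finset ℕ → Prop) [DecidablePred h] :
    ∑ π ∈ E, ∏ B ∈ π, (if h B then 0 else w B) =
      ∑ π ∈ E with ∀ B ∈ π, ¬ h B, ∏ B ∈ π, w B := by
  rw [Finset.sum_filter]
  refine Finset.sum_congr rfl fun π _ => ?_
  rw [← Finset.prod_ite_zero]
  exact Finset.prod_congr rfl fun B _ => by rw [ite_not]

end Concat

/-- Substitution is an algebra homomorphism, and substituting variables and then elements is
substituting the elements directly. -/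
theorem jointDistribution_orderedProd (φ : A →ₗ[ℝ] ℝ) {I : Type*} (X : I → A) {k : ℕ}
    {s : Fin k → ℕ} (u : ∀ i, Fin (s i) → I) :
    jointDistribution φ X (orderedProd fun i => freeAppellPolyAt φ X (u i)) =
      jointMoment φ (fun i => freeAppell φ (X ∘ u i)) := by
  rw [jointDistribution, jointMoment, orderedProd, orderedProd, evalAt, map_list_prod,
    List.map_ofFn]
  congr 3
  funext i
  rw [Function.comp_apply, freeAppellPolyAt, freeAppell, evalAt, evalAt, ← AlgHom.comp_apply]
  refine DFunLike.congr_fun ?_ _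
  ext j
  simp

end FreeAppell

end

/-! ### Specialization to plain and Appell segments -/

theorem mainTheorem2 {A : Type*} [Ring A] [Algebra ℝ A] (φ : A →ₗ[ℝ] ℝ) (hφ : φ 1 = 1)
    {I : Type*} (X : I → A) (k : ℕ) (s : Fin k → ℕ) (hs : ∀ i, 0 < s i)
    (u : ∀ i, Fin (s i) → I) :
    -- joint moments
    (jointMoment φ (fun i => orderedProd (X ∘ u i)) = jointMoment φ (X ∘ concat u) ∧
      jointMoment φ (X ∘ concat u) =
        ∑ π ∈ NC (∑ i, s i), partCumulant φ π (X ∘ concat u)) ∧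
    -- moments of free Appell polynomials
    jointMoment φ (fun i => freeAppell φ (X ∘ u i)) =
      ∑ π ∈ NC (∑ i, s i) with IsNonHomogeneous (intervalPartition s) π,
        partCumulant φ π (X ∘ concat u) ∧
    -- free cumulants with products as entries
    freeCumulant φ (fun i => orderedProd (X ∘ u i)) =
      ∑ π ∈ NC (∑ i, s i) with IsConnectedTo (intervalPartition s) π,
        partCumulant φ π (X ∘ concat u) ∧
    -- free cumulants of free Appell polynomials
    freeCumulant φ (fun i => freeAppell φ (X ∘ u i)) =
      ∑ π ∈ NC (∑ i, s i) with
          IsConnectedTo (intervalPartition s) π ∧ IsNonHomogeneous (intervalPartition s) π,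
        partCumulant φ π (X ∘ concat u) ∧
    -- linearization coefficients of the polynomials `A_u(x)` under the joint distribution of `X`
    jointDistribution φ X (orderedProd fun i => freeAppellPolyAt φ X (u i)) =
      ∑ π ∈ NC (∑ i, s i) with IsNonHomogeneous (intervalPartition s) π,
        partCumulant φ π (X ∘ concat u) := by
  set Y := ext0 (X ∘ concat u) with hY
  -- A plain segment starts its empty Appell interval at the end of the block, so all its plain
  -- positions come before.
  have hplain : ∀ i < k, ∀ x ∈ (plainSegment s i).plain, x < (plainSegment s i).start :=
    fun i _ x hx => (Finset.mem_Ico.1 hx).2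
  have happell : ∀ i < k, ∀ x ∈ (appellSegment s i).plain, x < (appellSegment s i).start :=
    fun i _ x hx => absurd hx (Finset.notMem_empty x)
  -- Plain segments have empty Appell intervals, so no nonempty class is forbidden.
  have hweight : ∀ B ⊆ Finset.range (∑ i, s i), B.Nonempty →
      (if ∃ i < k, B ⊆ (plainSegment s i).interval then 0 else cumulantOn φ Y B) =
        cumulantOn φ Y B := by
    intro B _ hB
    refine if_neg ?_
    rintro ⟨i, -, h⟩
    rw [plainSegment_interval, Finset.subset_empty] at h
    exact hB.ne_empty h
  have hsum : jointMoment φ (X ∘ concat u) = ncSum (cumulantOn φ Y) (Finset.range (∑ i, s i)) := by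
    rw [← apply_prodOn φ hφ, ← map_valOrderEmb_univ, ← orderedProd_comp, jointMoment]
    congr 2
    funext j
    exact (ext0_of_lt _ j.2).symm
  have h2 : jointMoment φ (fun i => freeAppell φ (X ∘ u i)) =
      ∑ π ∈ NC (∑ i, s i) with IsNonHomogeneous (intervalPartition s) π,
        partCumulant φ π (X ∘ concat u) := by
    have h := jointMoment_value φ hφ Y s (appellSegment s) (fun i _ => appellSegment_support i)
      happell
    simp only [hY, appellSegment_value φ hφ X u, appellSegment_interval] at h
    rw [h, ncSum, sum_prod_ite_zero]
    exact (sum_partCumulant_filter φ (X ∘ concat u) _ (fun π => ∀ B ∈ π, ¬ ∃ i < k, B ⊆ block s i)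
      isNonHomogeneous_iff).symm
  refine ⟨⟨?_, ?_⟩, h2, ?_, ?_, ?_⟩
  · have h := jointMoment_value φ hφ Y s (plainSegment s) (fun i _ => plainSegment_support i) hplain
    rw [ncSum_congr hweight] at h
    simp only [hY, plainSegment_value] at h
    rw [h, hsum]
  · have h := sum_partCumulant_filter φ (X ∘ concat u) (fun _ => True) (fun _ => True)
      fun _ => Iff.rfl
    simp only [Finset.filter_true] at h
    rw [hsum, h, ncSum]
  · have h := freeCumulant_value φ hφ Y s (plainSegment s) (fun i _ => plainSegment_support i)
      hplain
    simp only [hY, plainSegment_value] at h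
    rw [h, sum_partCumulant_filter φ _ _ _ (isConnectedTo_iff hs)]
    exact Finset.sum_congr rfl fun π hπ =>
      prod_congr_of_isSetPartition (mem_ncPart.1 (Finset.mem_filter.1 hπ).1).1 hweight
  · have h := freeCumulant_value φ hφ Y s (appellSegment s) (fun i _ => appellSegment_support i)
      happell
    simp only [hY, appellSegment_value φ hφ X u, appellSegment_interval] at h
    rw [h, sum_prod_ite_zero, Finset.filter_filter]
    exact (sum_partCumulant_filter φ (X ∘ concat u)
      (fun π => IsConnectedTo (intervalPartition s) π ∧ IsNonHomogeneous (intervalPartition s) π)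
      (fun π => ConnectedOver (blockIndex s) (Finset.range k) π ∧
        ∀ B ∈ π, ¬ ∃ i < k, B ⊆ block s i) fun π => and_congr (isConnectedTo_iff hs π) (isNonHomogeneous_iff π)).symm
  · rw [jointDistribution_orderedProd, h2]
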